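/- Let $n\ge 3$, let $G=\langle x_1,\dots,x_n \mid x_i^{-1}x_j^2x_i=x_j^{-2}\ (i\neq j)\rangle$, let $A=\langle x_1^2,\dots,x_n^2\rangle$ (a normal abelian subgroup of $G$), and let $W=G/A$, with $g\mapsto\bar g$ the quotient map. $W$ acts on $A$ by $\bar g\cdot a=gag^{-1}$. Let - $M_0$ be the additive group of integer $n\times n$ matrices with zero diagonal; - $\mathrm{Aut}_W(A)$ be the group of $W$-equivariant automorphisms of $A$; - $\mathrm{Aut}_S(A)$ be the group of pairs $(f,F)\in\mathrm{Aut}(A)\times\mathrm{Aut}(W)$ with $f(w\cdot a)=F(w)\cdot f(a)$ for all $w\in W$, $a\in A$. Then $\mathrm{Out}(W)$ acts on $\mathrm{Aut}_W(A)$ by $[F]\cdot u=fuf^{-1}$ for any $f$ with $(f,F)\in\mathrm{Aut}_S(A)$, and, with the semidirect product formed for this action, there is a commutative diagram with exact rows and columns $$ \begin{array}{ccccccccc} &&1&&1&&1&&\\ &&\downarrow&&\downarrow&&\downarrow&&\\ 1&\to&A&\to&G&\to&W&\to&1\\ &&{\scriptstyle\iota}\downarrow&&\downarrow&&\downarrow&&\\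 1&\to&M_0&\xrightarrow{\ t\ }&\mathrm{Aut}(G)&\to&\mathrm{Aut}_S(A)&\to&1\\ &&{\scriptstyle q}\downarrow&&\downarrow&&{\scriptstyle\kappa}\downarrow&&\\ 1&\to&H^1(W,A)&\to&\mathrm{Out}(G)&\to&\mathrm{Aut}_W(A)\rtimes\mathrm{Out}(W)&\to&1\\ &&\downarrow&&\downarrow&&\downarrow&&\\ &&1&&1&&1&& \end{array} $$ in which - the top row consists of the inclusion and the quotient map, and the middle column of $g\mapsto(h\mapsto ghg^{-1})$ and the quotient map; - $t$ sends a matrix $m$ to the automorphism $t_m$ with $t_m(x_i)=x_i(x_1^2)^{m_{i1}}\cdots(x_n^2)^{m_{in}}$ for all $i$; - $\mathrm{Aut}(G)\to\mathrm{Aut}_S(A)$ sends $\varphi$ to the pair of automorphisms that it induces on $A$ and on $W$; - $\iota$ sends $(x_1^2)^{z_1}\cdots(x_n^2)^{z_n}$ to the matrix with $(i,j)$ entry $-2z_j$ for $i\ne j$ and $0$ for $i=j$; - $q$ sends $m$ to the class of the cocycle $\bar g\mapsto t_m(g)g^{-1}$; - $W\to\mathrm{Aut}_S(A)$ sends $w$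 to the pair $(a\mapsto w\cdot a,\ v\mapsto wvw^{-1})$; - $\kappa$ sends $(u,1)$ to $u$ for $u\in\mathrm{Aut}_W(A)$, and the $\mathrm{Out}(W)$-component of $\kappa(f,F)$ is the class of $F$. Moreover $H^1(W,A)\cong\mathbb Z^{n(n-2)}\times(\mathbb Z/2)^n$ and $\mathrm{Aut}_W(A)\cong(\mathbb Z/2)^n$, so that, up to isomorphism, the bottom row is $$1\to\mathbb Z^{n(n-2)}\times(\mathbb Z/2)^n\to\mathrm{Out}(G)\to(\mathbb Z/2)^n\rtimes\mathrm{Out}(W)\to1,$$ where $\mathrm{Out}(W)$ acts on $(\mathbb Z/2)^n$ through the isomorphism with $\mathrm{Aut}_W(A)$. -/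

import Mathlib

namespace CHW

/-- The defining relators `x_i⁻¹ x_j² x_i x_j²`, `i ≠ j`, i.e. the relations
`x_i⁻¹ x_j² x_i = x_j⁻²`. -/
def rels (n : ℕ) : Set (FreeGroup (Fin n)) :=
  {r | ∃ i j : Fin n, i ≠ j ∧ r = (FreeGroup.of i)⁻¹ * FreeGroup.of j ^ 2 * FreeGroup.of i *
    FreeGroup.of j ^ 2}

/-- The combinatorial Hantzsche-Wendt group `G_n`. -/
abbrev G (n : ℕ) : Type := PresentedGroup (rels n)

/-- The generator `x_i` of `G_n`. -/
def x {n : ℕ} (i : Fin n) : G n := PresentedGroup.of i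

/-- The subgroup `A_n = ⟨x_1², …, x_n²⟩` of `G_n`. -/
def A (n : ℕ) : Subgroup (G n) := Subgroup.closure (Set.range fun i : Fin n => x i ^ 2)

theorem rel {n : ℕ} {i j : Fin n} (h : i ≠ j) :
    (x i)⁻¹ * x j ^ 2 * x i = (x j ^ 2)⁻¹ := by
  have h1 : (PresentedGroup.mk (rels n)) ((FreeGroup.of i)⁻¹ * FreeGroup.of j ^ 2 *
      FreeGroup.of i * FreeGroup.of j ^ 2) = 1 :=
    PresentedGroup.one_of_mem ⟨i, j, h, rfl⟩
  rw [map_mul, map_mul, map_mul, map_inv, map_pow] at h1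
  exact eq_inv_of_mul_eq_one_left h1

theorem rel' {n : ℕ} {i j : Fin n} (h : i ≠ j) :
    x i * x j ^ 2 * (x i)⁻¹ = (x j ^ 2)⁻¹ := by
  have h1 := congrArg (fun g => (x i * g * (x i)⁻¹)⁻¹) (rel h)
  simp only [mul_inv_rev, inv_inv] at h1
  simpa [mul_assoc] using h1.symm

theorem sq_mem {n : ℕ} (i : Fin n) : x i ^ 2 ∈ A n := Subgroup.subset_closure ⟨i, rfl⟩

instance A_normal (n : ℕ) : (A n).Normal := by
  have key : ∀ i : Fin n, ∀ a ∈ A n, x i * a * (x i)⁻¹ ∈ A n ∧ (x i)⁻¹ * a * x i ∈ A n := by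
    intro i a ha
    induction ha using Subgroup.closure_induction with
    | mem a ha =>
      obtain ⟨j, rfl⟩ := ha
      by_cases h : i = j
      · subst h
        have h1 : x i * x i ^ 2 * (x i)⁻¹ = x i ^ 2 := by group
        have h2 : (x i)⁻¹ * x i ^ 2 * x i = x i ^ 2 := by group
        exact ⟨by simpa only [h1] using sq_mem i, by simpa only [h2] using sq_mem i⟩
      · exact ⟨by simpa only [rel' h] using inv_mem (sq_mem j),
          by simpa only [rel h] using inv_mem (sq_mem j)⟩
    | one => simp
    | mul a b _ _ ha hb =>
      refine ⟨?_, ?_⟩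
      · have := mul_mem ha.1 hb.1
        rwa [show x i * a * (x i)⁻¹ * (x i * b * (x i)⁻¹) = x i * (a * b) * (x i)⁻¹ by
          group] at this
      · have := mul_mem ha.2 hb.2
        rwa [show (x i)⁻¹ * a * x i * ((x i)⁻¹ * b * x i) = (x i)⁻¹ * (a * b) * x i by
          group] at this
    | inv a _ ha =>
      refine ⟨?_, ?_⟩
      · have := inv_mem ha.1
        rwa [show (x i * a * (x i)⁻¹)⁻¹ = x i * a⁻¹ * (x i)⁻¹ by group] at this
      · have := inv_mem ha.2
        rwa [show ((x i)⁻¹ * a * x i)⁻¹ = (x i)⁻¹ * a⁻¹ * x i by group] at this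
  refine ⟨fun a ha g => ?_⟩
  have hg : g ∈ Subgroup.closure (Set.range (x : Fin n → G n)) := by
    have : Subgroup.closure (Set.range (x : Fin n → G n)) = ⊤ :=
      PresentedGroup.closure_range_of (rels n)
    rw [this]; trivial
  have : ∀ a ∈ A n, g * a * g⁻¹ ∈ A n ∧ g⁻¹ * a * g ∈ A n := by
    induction hg using Subgroup.closure_induction with
    | mem g hg =>
      obtain ⟨i, rfl⟩ := hg
      exact key i
    | one => intro a ha; simpa using ha
    | mul g h _ _ hg hh =>
      intro a ha
      refine ⟨?_, ?_⟩
      · have := (hg _ (hh a ha).1).1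
        rwa [show g * (h * a * h⁻¹) * g⁻¹ = g * h * a * (g * h)⁻¹ by group] at this
      · have := (hh _ (hg a ha).2).2
        rwa [show h⁻¹ * (g⁻¹ * a * g) * h = (g * h)⁻¹ * a * (g * h) by group] at this
    | inv g _ hg =>
      intro a ha
      have := hg a ha
      exact ⟨by simpa using this.2, by simpa using this.1⟩
  exact (this a ha).1

instance A_comm (n : ℕ) : IsMulCommutative (A n) := by
  apply Subgroup.isMulCommutative_closure
  rintro _ ⟨i, rfl⟩ _ ⟨j, rfl⟩
  by_cases h : i = j
  · subst h; rfl
  · have h1 : x i * x j ^ 2 = (x j ^ 2)⁻¹ * x i := mul_inv_eq_iff_eq_mul.1 (rel' h)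
    have h2 : x i * (x j ^ 2)⁻¹ = x j ^ 2 * x i := by
      have := congrArg (·⁻¹) (rel' h)
      simp only [mul_inv_rev, inv_inv] at this
      exact mul_inv_eq_iff_eq_mul.1 (by rw [mul_assoc]; exact this)
    change x i ^ 2 * x j ^ 2 = x j ^ 2 * x i ^ 2
    rw [pow_two (x i), mul_assoc, h1, ← mul_assoc, h2, mul_assoc]

instance A_commGroup (n : ℕ) : CommGroup (A n) :=
  { (inferInstance : Group (A n)) with mul_comm := fun a b => mul_comm' a b }

/-- The element `x_i²` of `A_n`. -/
def sq {n : ℕ} (i : Fin n) : A n := ⟨x i ^ 2, sq_mem i⟩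

/-- The element `(x_1²)^{z_1} ⋯ (x_n²)^{z_n}` of `A_n`. -/
def monomial {n : ℕ} (z : Fin n → ℤ) : A n := ∏ j, sq j ^ z j

/-- The quotient `W_n = G_n / A_n`. -/
abbrev W (n : ℕ) : Type := G n ⧸ A n

/-- The action of `W` on `A`, `ḡ ↦ (a ↦ g a g⁻¹)`. -/
def actW (n : ℕ) : W n →* MulAut (A n) :=
  QuotientGroup.lift (A n) MulAut.conjNormal (by
    intro a ha
    ext b
    rw [MulAut.conjNormal_apply, MulAut.one_apply]
    have h : a * b = b * a := congrArg Subtype.val (mul_comm' (⟨a, ha⟩ : A n) b)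
    rw [h, mul_inv_cancel_right])

/-- `A` as a `W`-module (written multiplicatively). -/
instance (n : ℕ) : MulDistribMulAction (W n) (A n) := MulDistribMulAction.compHom (A n) (actW n)

theorem coe_mk_smul {n : ℕ} (g : G n) (a : A n) :
    (((g : W n) • a : A n) : G n) = g * a * g⁻¹ := rfl

/-- `A` as an (additively written) representation of `W` over `ℤ`. -/
noncomputable abbrev repA (n : ℕ) : Rep ℤ (W n) := Rep.ofMulDistribMulAction (W n) (A n)

/-- The first cohomology group `H¹(W, A)`. -/
noncomputable abbrev H1 (n : ℕ) : Type := groupCohomology.H1 (repA n)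

/-- The group of inner automorphisms. -/
abbrev Inn (H : Type) [Group H] : Subgroup (MulAut H) := (MulAut.conj : H →* MulAut H).range

instance Inn_normal (H : Type) [Group H] : (Inn H).Normal := by
  refine ⟨?_⟩
  rintro _ ⟨h, rfl⟩ f
  refine ⟨f h, ?_⟩
  ext y
  simp [MulAut.mul_apply]

/-- The group of outer automorphisms `Out(H) = Aut(H) / Inn(H)`. -/
abbrev Out (H : Type) [Group H] : Type := MulAut H ⧸ Inn H

/-- `Aut_S(A)`: the semi-linear automorphisms of the `W`-module `A`, i.e. the pairs
`(f, F) ∈ Aut(A) × Aut(W)` with `f (w • a) = F w • f a`. -/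
def AutS (n : ℕ) : Subgroup (MulAut (A n) × MulAut (W n)) where
  carrier := {s | ∀ (w : W n) (a : A n), s.1 (w • a) = s.2 w • s.1 a}
  one_mem' := fun _ _ => rfl
  mul_mem' := by
    intro s t hs ht w a
    change s.1 (t.1 (w • a)) = s.2 (t.2 w) • s.1 (t.1 a)
    rw [ht w a, hs]
  inv_mem' := by
    intro s hs w a
    change s.1.symm (w • a) = s.2.symm w • s.1.symm a
    rw [MulEquiv.symm_apply_eq, hs]
    simp

/-- `Aut_W(A)`: the automorphisms of the `W`-module `A`. -/
def AutW (n : ℕ) : Subgroup (MulAut (A n)) where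
  carrier := {f | ∀ (w : W n) (a : A n), f (w • a) = w • f a}
  one_mem' := fun _ _ => rfl
  mul_mem' := by
    intro s t hs ht w a
    change s (t (w • a)) = w • s (t a)
    rw [ht w a, hs]
  inv_mem' := by
    intro s hs w a
    change s.symm (w • a) = w • s.symm a
    rw [MulEquiv.symm_apply_eq, hs]
    simp

/-- The inclusion `Aut_W(A) → Aut_S(A)`, `f ↦ (f, 1)`. -/
def AutW.toAutS (n : ℕ) : AutW n →* AutS n where
  toFun f := ⟨(f.1, 1), f.2⟩
  map_one' := rfl
  map_mul' _ _ := rfl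

/-- The map `W → Aut_S(A)`, `w ↦ (a ↦ w • a, v ↦ w v w⁻¹)`. -/
def wToAutS (n : ℕ) : W n →* AutS n where
  toFun w := ⟨(actW n w, MulAut.conj w), by
    intro v a
    change w • v • a = (w * v * w⁻¹) • w • a
    rw [← mul_smul, ← mul_smul, inv_mul_cancel_right]⟩
  map_one' := by
    apply Subtype.ext
    simp
  map_mul' v w := by
    apply Subtype.ext
    simp

/-- `M_0`: the integer `n × n` matrices with zero diagonal. The operation
`(a * b)_ij = a_ij + (1 + 2 a_jj) b_ij` on integer matrices restricts to addition on `M_0`. -/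
def M0 (n : ℕ) : AddSubgroup (Matrix (Fin n) (Fin n) ℤ) where
  carrier := {m | ∀ i, m i i = 0}
  zero_mem' := fun _ => rfl
  add_mem' := by
    intro a b ha hb i
    simp [ha i, hb i]
  neg_mem' := by
    intro a ha i
    simp [ha i]

/-- Exactness of `1 → X → Y → Z → 1`. -/
def ShortExact {X Y Z : Type*} [Group X] [Group Y] [Group Z] (f : X →* Y) (g : Y →* Z) : Prop :=
  Function.Injective f ∧ f.range = g.ker ∧ Function.Surjective g

end CHW

open CHW

namespace CHW

/-! The quotient `W` is the free product of `n` copies of `ℤ/2`, and `A` is free abelian on the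
squares `x_i²`. In this basis `W` acts by sign changes: `y i` fixes the `i`-th coordinate and
negates the others. Reduced words give what is needed about `W`: involutions are conjugate to
generators, the centralizer of `y k` is `{1, y k}`, and for `n ≥ 3` only `1` commutes with all its
conjugates by generators. The last fact makes `A` characteristic in `G`, so automorphisms of `G`
restrict to `A` and descend to `W`.

Right column: the `W`-automorphisms of `A` are exactly the sign changes (`mem_AutW_iff`). The
projection of `Aut_S(A)` to `Aut(W)` has a section: if `F (y i) = w * y k * w⁻¹`, send `x_i²` to `w
• x_k²` (`autSection`). It carries inner automorphisms to the action of `W`, and this splitting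
produces `κ`.

Middle row: a semilinear pair lifts to `G` because conjugates of `x_k` and of `x_k⁻¹` realise every
required sign (`restrict_surjective`). An automorphism trivial on `A` and `W` multiplies each `x_i`
by some `a_i ∈ A`, and `(x_i a_i)² = x_i²` forces the `i`-th coordinate of `a_i` to vanish, which
gives `M_0`.

Left column: such automorphisms are the same as 1-cocycles, and conjugations by elements of `A` are
the coboundaries. The bottom row then follows by a diagram chase, and `H¹` is read off from `M_0`
modulo matrices whose columns are constant and even off the diagonal. -/

/-! ### Generators and universal properties of `G` and `W` -/

theorem G_closure (n : ℕ) : Subgroup.closure (Set.range (x : Fin n → G n)) = ⊤ :=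
  PresentedGroup.closure_range_of (rels n)

/-- The generator `x̄_i` of `W_n`. -/
def y {n : ℕ} (i : Fin n) : W n := (x i : W n)

theorem W_closure (n : ℕ) : Subgroup.closure (Set.range (y : Fin n → W n)) = ⊤ := by
  have h := congrArg (Subgroup.map (QuotientGroup.mk' (A n))) (G_closure n)
  rw [MonoidHom.map_closure, ← Set.range_comp,
    Subgroup.map_top_of_surjective _ (QuotientGroup.mk'_surjective _)] at h
  exact h

theorem y_mul_y {n : ℕ} (i : Fin n) : y i * y i = 1 := by
  have h : ((x i ^ 2 : G n) : W n) = 1 := (QuotientGroup.eq_one_iff _).2 (sq_mem i)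
  rwa [pow_two] at h

theorem y_inv {n : ℕ} (i : Fin n) : (y i)⁻¹ = y i := inv_eq_of_mul_eq_one_left (y_mul_y i)

theorem y_mul_cancel {n : ℕ} (i : Fin n) (w : W n) : y i * (y i * w) = w := by
  rw [← mul_assoc, y_mul_y, one_mul]

/-- Homomorphisms out of `G` are determined by images of the generators with the right
relations. -/
def liftG {n : ℕ} {H : Type*} [Group H] (g : Fin n → H)
    (hg : ∀ i j, i ≠ j → (g i)⁻¹ * g j ^ 2 * g i = (g j ^ 2)⁻¹) : G n →* H :=
  PresentedGroup.toGroup (f := g) (by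
    rintro _ ⟨i, j, hij, rfl⟩
    simp only [map_mul, map_inv, map_pow, FreeGroup.lift_apply_of]
    rw [hg i j hij, inv_mul_cancel])

@[simp] theorem liftG_x {n : ℕ} {H : Type*} [Group H] (g : Fin n → H)
    (hg : ∀ i j, i ≠ j → (g i)⁻¹ * g j ^ 2 * g i = (g j ^ 2)⁻¹) (i : Fin n) :
    liftG g hg (x i) = g i := PresentedGroup.toGroup.of _

theorem homG_ext {n : ℕ} {H : Type*} [Monoid H] {f g : G n →* H}
    (h : ∀ i, f (x i) = g (x i)) : f = g :=
  MonoidHom.eq_of_eqOn_dense (G_closure n) (by rintro _ ⟨i, rfl⟩; exact h i)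

/-- Homomorphisms out of `W` are families of elements with trivial square. -/
def liftW {n : ℕ} {H : Type*} [Group H] (g : Fin n → H) (hg : ∀ i, g i ^ 2 = 1) : W n →* H :=
  QuotientGroup.lift (A n) (liftG g (by intro i j _; simp [hg])) (by
    intro a ha
    induction ha using Subgroup.closure_induction with
    | mem a ha => obtain ⟨j, rfl⟩ := ha; simp [hg]
    | one => simp
    | mul a b _ _ ha hb => exact mul_mem ha hb
    | inv a _ ha => exact inv_mem ha)

@[simp] theorem liftW_y {n : ℕ} {H : Type*} [Group H] (g : Fin n → H) (hg : ∀ i, g i ^ 2 = 1)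
    (i : Fin n) : liftW g hg (y i) = g i := liftG_x g (by intro i j _; simp [hg]) i

/-! ### Normal forms in `W` -/

/-- The product of a word in the generators of `W`. -/
def wprod {n : ℕ} (l : List (Fin n)) : W n := (l.map y).prod

@[simp] theorem wprod_nil {n : ℕ} : wprod ([] : List (Fin n)) = 1 := rfl

@[simp] theorem wprod_cons {n : ℕ} (i : Fin n) (l : List (Fin n)) :
    wprod (i :: l) = y i * wprod l := by simp [wprod]

@[simp] theorem wprod_append {n : ℕ} (l l' : List (Fin n)) :
    wprod (l ++ l') = wprod l * wprod l' := by simp [wprod]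

theorem wprod_reverse {n : ℕ} (l : List (Fin n)) : wprod l.reverse = (wprod l)⁻¹ := by
  induction l with
  | nil => simp
  | cons i l ih => simp [ih, y_inv]

/-- Left multiplication of a reduced word by a generator. -/
def push {n : ℕ} (i : Fin n) : List (Fin n) → List (Fin n)
  | [] => [i]
  | j :: l => if i = j then l else i :: j :: l

theorem push_isChain {n : ℕ} (i : Fin n) {l : List (Fin n)} (hl : l.IsChain (· ≠ ·)) :
    (push i l).IsChain (· ≠ ·) := by
  cases l with
  | nil => simp [push]
  | cons j l =>
    by_cases h : i = j
    · simpa [push, h] using hl.tail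
    · simp only [push, h, if_false]
      exact List.isChain_cons_cons.2 ⟨h, hl⟩

/-- After cancelling a leading `i`, pushing `i` again must not cancel a second time; reducedness
ensures that the next letter differs from `i`. The relation `y i * y i = 1` thus holds for the
action on reduced words. -/
theorem push_push {n : ℕ} (i : Fin n) {l : List (Fin n)} (hl : l.IsChain (· ≠ ·)) :
    push i (push i l) = l := by
  cases l with
  | nil => simp [push]
  | cons j l =>
    by_cases h : i = j
    · subst h
      cases l with
      | nil => simp [push]
      | cons k l => simp [push, (List.isChain_cons_cons.1 hl).1]
    · simp [push, h]

theorem push_of_isChain {n : ℕ} {i : Fin n} {l : List (Fin n)}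
    (hl : (i :: l).IsChain (· ≠ ·)) : push i l = i :: l := by
  cases l with
  | nil => rfl
  | cons j l => simp [push, (List.isChain_cons_cons.1 hl).1]

theorem wprod_push {n : ℕ} (i : Fin n) (l : List (Fin n)) :
    wprod (push i l) = y i * wprod l := by
  cases l with
  | nil => simp [push]
  | cons j l =>
    by_cases h : i = j
    · simp [push, h, y_mul_cancel]
    · simp [push, h]

/-- The permutation of the reduced words given by left multiplication by a generator. -/
def pushPerm {n : ℕ} (i : Fin n) : Equiv.Perm {l : List (Fin n) // l.IsChain (· ≠ ·)} where
  toFun l := ⟨push i l.1, push_isChain i l.2⟩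
  invFun l := ⟨push i l.1, push_isChain i l.2⟩
  left_inv l := Subtype.ext (push_push i l.2)
  right_inv l := Subtype.ext (push_push i l.2)

/-- The action of `W` on reduced words. -/
def wordAct (n : ℕ) : W n →* Equiv.Perm {l : List (Fin n) // l.IsChain (· ≠ ·)} :=
  liftW pushPerm (by
    intro i
    ext1 l
    exact Subtype.ext (push_push i l.2))

/-- Van der Waerden's trick: acting on the empty word recovers the reduced word, so a reduced word
is determined by its product. -/
theorem wordAct_wprod {n : ℕ} (l : List (Fin n)) (hl : l.IsChain (· ≠ ·)) :
    wordAct n (wprod l) ⟨[], List.isChain_nil⟩ = ⟨l, hl⟩ := by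
  induction l with
  | nil => simp
  | cons i l ih =>
    rw [wprod_cons, map_mul, Equiv.Perm.mul_apply, ih hl.tail, wordAct, liftW_y]
    exact Subtype.ext (push_of_isChain hl)

theorem wprod_injOn {n : ℕ} {l l' : List (Fin n)} (hl : l.IsChain (· ≠ ·))
    (hl' : l'.IsChain (· ≠ ·)) (h : wprod l = wprod l') : l = l' := by
  have := wordAct_wprod l hl
  rw [h, wordAct_wprod l' hl'] at this
  exact (congrArg Subtype.val this).symm

theorem exists_word {n : ℕ} (w : W n) :
    ∃ l : List (Fin n), l.IsChain (· ≠ ·) ∧ wprod l = w := by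
  have hw : w ∈ Subgroup.closure (Set.range (y : Fin n → W n)) := W_closure n ▸ trivial
  induction hw using Subgroup.closure_induction_left with
  | one => exact ⟨[], List.isChain_nil, rfl⟩
  | mul_left v hv w _ ih =>
    obtain ⟨i, rfl⟩ := hv
    obtain ⟨l, hl, rfl⟩ := ih
    exact ⟨push i l, push_isChain i hl, wprod_push i l⟩
  | inv_mul_cancel v hv w _ ih =>
    obtain ⟨i, rfl⟩ := hv
    obtain ⟨l, hl, rfl⟩ := ih
    exact ⟨push i l, push_isChain i hl, by rw [y_inv]; exact wprod_push i l⟩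

theorem y_ne_one {n : ℕ} (i : Fin n) : y i ≠ 1 := by
  intro h
  have := wprod_injOn (l := [i]) (l' := []) (by simp) (by simp) (by simpa using h)
  simp at this

theorem y_injective {n : ℕ} : Function.Injective (y : Fin n → W n) := by
  intro i j h
  have := wprod_injOn (l := [i]) (l' := [j]) (by simp) (by simp) (by simpa using h)
  simpa using this

/-- Every involution of `W` is conjugate to a generator. -/
theorem exists_conj_y {n : ℕ} {v : W n} (hv : v ≠ 1) (hv2 : v * v = 1) :
    ∃ (w : W n) (k : Fin n), v = w * y k * w⁻¹ := by
  obtain ⟨l, hl, rfl⟩ := exists_word v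
  -- The reversed word is reduced and represents the inverse; an involution is its own inverse, so
  -- its word is a palindrome. Peeling off equal end letters conjugates by a generator.
  have hp : l.reverse = l := by
    refine wprod_injOn ?_ hl ?_
    · rw [List.isChain_reverse]
      exact hl.imp fun _ _ h => h.symm
    · rw [wprod_reverse]
      exact inv_eq_of_mul_eq_one_left hv2
  have hpal : l.Palindrome := List.Palindrome.of_reverse_eq hp
  clear hv2 hp
  induction hpal with
  | nil => exact absurd rfl hv
  | singleton k => exact ⟨1, k, by simp⟩
  | @cons_concat i l hpal ih =>
    have hl' : l.IsChain (· ≠ ·) := (List.isChain_append.1 hl.tail).1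
    by_cases h : wprod l = 1
    -- An empty core would leave the word `[i, i]`, which is not reduced.
    · have : l = [] := wprod_injOn hl' List.isChain_nil h
      subst this
      simp at hl
    · obtain ⟨w, k, hw⟩ := ih hl' h
      refine ⟨y i * w, k, ?_⟩
      simp [hw, y_inv, mul_assoc]

/-- The centralizer of a generator of `W`. -/
theorem eq_one_or_eq_y_of_commute {n : ℕ} {v : W n} {k : Fin n} (h : Commute v (y k)) :
    v = 1 ∨ v = y k := by
  -- If `l` ends in `k`, cancelling that letter gives a reduced word shorter than `k :: l` with the
  -- same product. Otherwise `l ++ [k]` and `k :: l` are both reduced, hence equal, although a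
  -- nonempty `l` does not start with `k`.
  have main : ∀ l : List (Fin n), (k :: l).IsChain (· ≠ ·) → Commute (wprod l) (y k) →
      l = [] := by
    intro l hl hc
    rcases List.eq_nil_or_concat l with h0 | ⟨l', b, hb⟩
    · exact h0
    rw [List.concat_eq_append] at hb
    exfalso
    by_cases hbk : b = k
    · have h1 : l' = k :: l := by
        refine wprod_injOn ?_ hl ?_
        · have := hl.tail
          rw [List.tail_cons, hb] at this
          exact (List.isChain_append.1 this).1
        · rw [wprod_cons, ← hc.eq, hb, hbk]
          simp [mul_assoc, y_mul_y]
      have h2 := congrArg List.length h1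
      rw [hb] at h2
      simp at h2
      omega
    · have h1 : l ++ [k] = k :: l := by
        refine wprod_injOn ?_ hl ?_
        · rw [List.isChain_append]
          refine ⟨hl.tail, by simp, ?_⟩
          intro p hp q hq
          rw [hb] at hp
          simp at hp hq
          rw [← hp, ← hq]
          exact hbk
        · rw [wprod_cons, ← hc.eq]; simp
      cases l with
      | nil => simp at hb
      | cons c l =>
        simp only [List.cons_append, List.cons.injEq] at h1
        exact (List.isChain_cons_cons.1 hl).1 h1.1.symm
  obtain ⟨l, hl, rfl⟩ := exists_word v
  by_cases hk : (k :: l).IsChain (· ≠ ·)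
  · left; rw [main l hk h, wprod_nil]
  -- A leading `k` can be stripped without losing commutation with `y k`.
  · right
    cases l with
    | nil => simp at hk
    | cons c l =>
      have hkc : k = c := by
        by_contra hne
        exact hk (List.isChain_cons_cons.2 ⟨hne, hl⟩)
      subst hkc
      have hc : Commute (wprod l) (y k) := by
        have : wprod l = y k * wprod (k :: l) := by simp [y_mul_cancel]
        rw [this]
        exact (Commute.refl _).mul_left h
      rw [main l hl hc]
      simp

/-- `W` has trivial center. -/
theorem eq_one_of_forall_commute {n : ℕ} (hn : 2 ≤ n) {v : W n} (h : ∀ k, Commute v (y k)) :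
    v = 1 := by
  rcases eq_one_or_eq_y_of_commute (h ⟨0, by omega⟩) with h0 | h0
  · exact h0
  rcases eq_one_or_eq_y_of_commute (h ⟨1, by omega⟩) with h1 | h1
  · exact h1
  rw [h0] at h1
  simpa using y_injective h1

/-- For `n ≥ 3` an element of `W` commuting with its conjugates by generators is trivial. -/
theorem eq_one_of_commute_conj {n : ℕ} (hn : 3 ≤ n) {v : W n}
    (h : ∀ k, Commute v (y k * v * y k)) : v = 1 := by
  obtain ⟨l, hl, rfl⟩ := exists_word v
  cases l with
  | nil => rfl
  | cons a l =>
    exfalso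
    -- Three letters leave room for a `k` different from both the first and the last letter of `v`.
    -- Then `v k v k` and `k v k v` are reduced words with different first letters but, by
    -- commutation, equal products.
    set b := (a :: l).getLast (by simp) with hb
    obtain ⟨k, hk⟩ : ∃ k : Fin n, k ∉ ({a, b} : Finset (Fin n)) := by
      by_contra hcon
      push Not at hcon
      have h1 : (Finset.univ : Finset (Fin n)) ⊆ {a, b} := fun k _ => hcon k
      have h2 := Finset.card_le_card h1
      have h3 : ({a, b} : Finset (Fin n)).card ≤ 2 := Finset.card_le_two
      simp at h2
      omega
    simp only [Finset.mem_insert, Finset.mem_singleton, not_or] at hk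
    have c1 : (k :: a :: l).IsChain (· ≠ ·) := List.isChain_cons_cons.2 ⟨hk.1, hl⟩
    have cl : ∀ {m : List (Fin n)}, (k :: m).IsChain (· ≠ ·) →
        ((a :: l) ++ k :: m).IsChain (· ≠ ·) := by
      intro m hm
      rw [List.isChain_append]
      refine ⟨hl, hm, ?_⟩
      intro p hp q hq
      rw [List.getLast?_eq_getLast_of_ne_nil (by simp)] at hp
      simp only [Option.mem_def, Option.some.injEq, List.head?_cons] at hp hq
      rw [← hp, ← hq]
      exact Ne.symm hk.2
    have c2 : ((a :: l) ++ k :: ((a :: l) ++ [k])).IsChain (· ≠ ·) :=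
      cl (List.isChain_cons_cons.2 ⟨hk.1, cl (by simp)⟩)
    have c3 : (k :: ((a :: l) ++ k :: (a :: l))).IsChain (· ≠ ·) :=
      List.isChain_cons_cons.2 ⟨hk.1, cl c1⟩
    have := wprod_injOn c2 c3 (by
      have := (h k).eq
      simp only [wprod_append, wprod_cons, wprod_nil, mul_one, mul_assoc] at this ⊢
      exact this)
    simp only [List.cons_append, List.cons.injEq] at this
    exact hk.1 this.1.symm

/-! ### The module `A` -/

/-- The homomorphism to the infinite dihedral group detecting the `j`-th coordinate of `A`. -/
def toDihedral {n : ℕ} (j : Fin n) : G n →* DihedralGroup 0 :=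
  -- `DihedralGroup 0` is infinite since `ZMod 0` is `ℤ`. The reflection squares to `1` and inverts
  -- rotations, while `x j ^ 2` becomes a rotation of infinite order.
  liftG (fun i => if i = j then .r 1 else .sr 0) (by
    intro i k hik
    by_cases hk : k = j
    · have hi : i ≠ j := fun h => hik (h.trans hk.symm)
      simp [hk, hi, pow_two]
    · by_cases hi : i = j <;> simp [hk, hi, pow_two])

theorem toDihedral_monomial {n : ℕ} (j : Fin n) (z : Fin n → ℤ) :
    toDihedral j (monomial z : G n) = .r (2 * (Int.cast (z j) : ZMod 0)) := by
  have h : ∀ i, ((toDihedral j).comp (A n).subtype) (sq i) = if i = j then .r 2 else 1 := by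
    intro i
    change toDihedral j (x i ^ 2) = _
    by_cases hi : i = j
    · simp [toDihedral, hi, pow_two]; norm_num
    · simp [toDihedral, hi, pow_two]
  -- The target is not commutative, so the product is taken over a list rather than over a finset.
  have h2 : ∀ l : List (Fin n), l.Nodup → ((toDihedral j).comp (A n).subtype)
      (l.map fun i => sq i ^ z i).prod = if j ∈ l then .r (2 * (Int.cast (z j) : ZMod 0)) else 1 := by
    intro l hl
    induction l with
    | nil => simp
    | cons i l ih =>
      rw [List.map_cons, List.prod_cons, map_mul, ih hl.of_cons, map_zpow, h]
      by_cases hi : i = j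
      · subst hi
        have : i ∉ l := (List.nodup_cons.1 hl).1
        simp [this]
      · simp [hi, Ne.symm hi]
  have h3 := h2 (List.finRange n) (List.nodup_finRange n)
  rw [if_pos (List.mem_finRange j)] at h3
  rw [← h3, monomial, ← List.prod_ofFn, List.ofFn_eq_map]
  rfl

theorem monomial_injective {n : ℕ} : Function.Injective (monomial : (Fin n → ℤ) → A n) := by
  intro z z' h
  funext j
  have h1 := toDihedral_monomial j z
  rw [h, toDihedral_monomial j z'] at h1
  replace h1 := DihedralGroup.r.inj h1
  have h2 : 2 * z' j = 2 * z j := h1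
  omega

theorem monomial_add {n : ℕ} (z z' : Fin n → ℤ) :
    monomial (z + z') = monomial z * monomial z' := by
  simp [monomial, zpow_add, Finset.prod_mul_distrib]

theorem monomial_single {n : ℕ} (j : Fin n) (c : ℤ) : monomial (Pi.single j c) = sq j ^ c := by
  rw [monomial, Finset.prod_eq_single j]
  · simp
  · intro i _ hi; simp [hi]
  · simp

theorem A_closure (n : ℕ) : Subgroup.closure (Set.range (sq : Fin n → A n)) = ⊤ := by
  have h := Subgroup.closure_closure_coe_preimage
    (k := Set.range fun i : Fin n => (x i ^ 2 : G n))
  have h2 : (Set.range (sq : Fin n → A n)) =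
      (Subtype.val : A n → G n) ⁻¹' (Set.range fun i : Fin n => (x i ^ 2 : G n)) := by
    ext a
    constructor
    · rintro ⟨i, rfl⟩; exact ⟨i, rfl⟩
    · rintro ⟨i, hi⟩; exact ⟨i, Subtype.ext hi⟩
  rw [h2]; exact h

/-- `z ↦ (x_1²)^{z_1} ⋯ (x_n²)^{z_n}` as a homomorphism. -/
def monomialHom (n : ℕ) : Multiplicative (Fin n → ℤ) →* A n where
  toFun z := monomial z.toAdd
  map_one' := by simp [monomial]
  map_mul' _ _ := monomial_add _ _

theorem monomialHom_surjective (n : ℕ) : Function.Surjective (monomialHom n) := by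
  rw [← MonoidHom.range_eq_top, eq_top_iff, ← A_closure, Subgroup.closure_le]
  rintro _ ⟨i, rfl⟩
  exact ⟨Multiplicative.ofAdd (Pi.single i 1), by
    change monomial _ = _; rw [toAdd_ofAdd, monomial_single, zpow_one]⟩

/-- `A` is free abelian on the squares of the generators. -/
noncomputable def monomialEquiv (n : ℕ) : Multiplicative (Fin n → ℤ) ≃* A n :=
  MulEquiv.ofBijective (monomialHom n) ⟨fun _ _ h => monomial_injective h,
    monomialHom_surjective n⟩

/-- The coordinates of an element of `A`. -/
noncomputable def coord {n : ℕ} (a : A n) : Fin n → ℤ := ((monomialEquiv n).symm a).toAdd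

@[simp] theorem monomial_coord {n : ℕ} (a : A n) : monomial (coord a) = a :=
  (monomialEquiv n).apply_symm_apply a

@[simp] theorem coord_monomial {n : ℕ} (z : Fin n → ℤ) : coord (monomial z) = z :=
  monomial_injective (monomial_coord _)

@[simp] theorem coord_mul {n : ℕ} (a b : A n) : coord (a * b) = coord a + coord b := by
  simp [coord]

@[simp] theorem coord_one {n : ℕ} : coord (1 : A n) = 0 := by
  simp [coord]

@[simp] theorem coord_inv {n : ℕ} (a : A n) : coord a⁻¹ = -coord a := by
  simp [coord]

@[simp] theorem coord_sq {n : ℕ} (i : Fin n) : coord (sq i) = Pi.single i 1 := by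
  rw [← zpow_one (sq i), ← monomial_single, coord_monomial]

theorem coord_injective {n : ℕ} : Function.Injective (coord : A n → Fin n → ℤ) :=
  Function.LeftInverse.injective monomial_coord

theorem sq_ne_inv {n : ℕ} (i : Fin n) : sq i ≠ (sq i)⁻¹ := by
  intro h
  have := congrFun (congrArg coord h) i
  simp at this

theorem homA_ext {n : ℕ} {H : Type*} [Monoid H] {f g : A n →* H}
    (h : ∀ i, f (sq i) = g (sq i)) : f = g :=
  MonoidHom.eq_of_eqOn_dense (A_closure n) (by rintro _ ⟨i, rfl⟩; exact h i)

theorem mulAutA_ext {n : ℕ} {f g : MulAut (A n)} (h : ∀ i, f (sq i) = g (sq i)) : f = g := by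
  ext1 a
  exact DFunLike.congr_fun (homA_ext (f := f.toMonoidHom) (g := g.toMonoidHom) h) a

/-- The homomorphism `A → H` with prescribed images of the basis. -/
noncomputable def liftA {n : ℕ} {H : Type*} [CommGroup H] (b : Fin n → H) : A n →* H where
  toFun a := ∏ i, b i ^ coord a i
  map_one' := by simp
  map_mul' a a' := by simp [zpow_add, Finset.prod_mul_distrib]

@[simp] theorem liftA_sq {n : ℕ} {H : Type*} [CommGroup H] (b : Fin n → H) (i : Fin n) :
    liftA b (sq i) = b i := by
  change ∏ j, b j ^ coord (sq i) j = b i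
  rw [Finset.prod_eq_single i]
  · simp
  · intro j _ hj; simp [hj]
  · simp

theorem y_smul_sq_self {n : ℕ} (i : Fin n) : y i • sq i = sq i := by
  apply Subtype.ext
  change x i * x i ^ 2 * (x i)⁻¹ = x i ^ 2
  group

theorem y_smul_sq_of_ne {n : ℕ} {i j : Fin n} (h : i ≠ j) : y i • sq j = (sq j)⁻¹ :=
  Subtype.ext (rel' h)

/-- Inversion is correct on every coordinate but the `i`-th; the factor `sq i ^ (2 * coord a i)`
repairs that one. Both sides are multiplicative in `a`, so the basis suffices. -/
theorem y_smul {n : ℕ} (i : Fin n) (a : A n) :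
    y i • a = sq i ^ (2 * coord a i) * a⁻¹ := by
  have ha : a ∈ Subgroup.closure (Set.range (sq : Fin n → A n)) := A_closure n ▸ trivial
  induction ha using Subgroup.closure_induction with
  | mem a ha =>
    obtain ⟨j, rfl⟩ := ha
    by_cases h : i = j
    · subst h
      rw [y_smul_sq_self, coord_sq, Pi.single_eq_same]
      group
    · rw [y_smul_sq_of_ne h, coord_sq, Pi.single_eq_of_ne h]
      simp
  | one => simp
  | mul a b _ _ ha hb =>
    rw [smul_mul', ha, hb, coord_mul, Pi.add_apply, mul_add, zpow_add, mul_inv,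
      mul_mul_mul_comm]
  | inv a _ ha =>
    rw [smul_inv', ha, coord_inv, Pi.neg_apply, mul_neg, zpow_neg, mul_inv]

theorem coord_y_smul {n : ℕ} (i j : Fin n) (a : A n) :
    coord (y i • a) j = if i = j then coord a j else -coord a j := by
  rw [y_smul, coord_mul, ← monomial_single, coord_monomial, coord_inv, Pi.add_apply,
    Pi.neg_apply]
  by_cases h : i = j
  · subst h; simp; ring
  · simp [h, Ne.symm h]

/-- Elements of `A` fixed by a generator of `W`. -/
theorem eq_zpow_of_y_smul {n : ℕ} {i : Fin n} {a : A n} (h : y i • a = a) :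
    a = sq i ^ coord a i := by
  apply coord_injective
  rw [← monomial_single, coord_monomial]
  funext j
  by_cases hij : i = j
  · subst hij; simp
  · have := congrFun (congrArg coord h) j
    rw [coord_y_smul, if_neg hij] at this
    rw [Pi.single_eq_of_ne (Ne.symm hij)]
    omega

theorem y_smul_eq_inv_iff {n : ℕ} {i : Fin n} {a : A n} :
    y i • a = a⁻¹ ↔ coord a i = 0 := by
  constructor
  · intro h
    have := congrFun (congrArg coord h) i
    rw [coord_y_smul, if_pos rfl, coord_inv, Pi.neg_apply] at this
    omega
  · intro h
    rw [y_smul, h]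
    simp

/-! ### Diagonal automorphisms of `A` -/

/-- Automorphisms of `A` sending every basis element to itself or its inverse. -/
def IsDiag {n : ℕ} (f : MulAut (A n)) : Prop := ∀ k, f (sq k) = sq k ∨ f (sq k) = (sq k)⁻¹

theorem IsDiag.mul {n : ℕ} {f g : MulAut (A n)} (hf : IsDiag f) (hg : IsDiag g) :
    IsDiag (f * g) := by
  intro k
  rw [MulAut.mul_apply]
  rcases hg k with h | h <;> rcases hf k with h' | h' <;> simp [h, h']

theorem IsDiag.commute {n : ℕ} {f g : MulAut (A n)} (hf : IsDiag f) (hg : IsDiag g) :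
    Commute f g := by
  refine mulAutA_ext fun k => ?_
  rw [MulAut.mul_apply, MulAut.mul_apply]
  rcases hg k with h | h <;> rcases hf k with h' | h' <;> simp [h, h']

theorem isDiag_actW {n : ℕ} (w : W n) : IsDiag (actW n w) := by
  have hw : w ∈ Subgroup.closure (Set.range (y : Fin n → W n)) := W_closure n ▸ trivial
  induction hw using Subgroup.closure_induction_left with
  | one => rw [map_one]; exact fun k => Or.inl rfl
  | mul_left v hv w _ ih =>
    obtain ⟨i, rfl⟩ := hv
    rw [map_mul]
    refine IsDiag.mul (fun k => ?_) ih
    by_cases h : i = k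
    · subst h; exact Or.inl (y_smul_sq_self i)
    · exact Or.inr (y_smul_sq_of_ne h)
  | inv_mul_cancel v hv w _ ih =>
    obtain ⟨i, rfl⟩ := hv
    rw [map_mul, y_inv]
    refine IsDiag.mul (fun k => ?_) ih
    by_cases h : i = k
    · subst h; exact Or.inl (y_smul_sq_self i)
    · exact Or.inr (y_smul_sq_of_ne h)

/-- An equivariant `f` preserves the fixed subgroup of `y k`, which is generated by `sq k`. So does
`f⁻¹`, and the two exponents multiply to `1`. Conversely, diagonal automorphisms commute with one
another, and `W` acts by diagonal ones. -/
theorem mem_AutW_iff {n : ℕ} {f : MulAut (A n)} : f ∈ AutW n ↔ IsDiag f := by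
  constructor
  · intro hf k
    have h1 : y k • f (sq k) = f (sq k) := by rw [← hf, y_smul_sq_self]
    have h2 : y k • f⁻¹ (sq k) = f⁻¹ (sq k) := by
      rw [← (inv_mem hf : f⁻¹ ∈ AutW n), y_smul_sq_self]
    set p := coord (f (sq k)) k
    set q := coord (f⁻¹ (sq k)) k
    have h3 : sq k ^ (p * q) = sq k := by
      rw [zpow_mul, ← eq_zpow_of_y_smul h1, ← map_zpow, ← eq_zpow_of_y_smul h2,
        MulAut.apply_inv_self]
    have h4 : p * q = 1 := by
      have := congrArg (fun a => coord a k) h3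
      rw [← monomial_single, coord_monomial] at this
      simpa using this
    rw [eq_zpow_of_y_smul h1]
    rcases Int.eq_one_or_neg_one_of_mul_eq_one h4 with h | h
    · left; rw [show coord (f (sq k)) k = 1 from h, zpow_one]
    · right; rw [show coord (f (sq k)) k = -1 from h, zpow_neg_one]
  · intro hf w a
    exact DFunLike.congr_fun (hf.commute (isDiag_actW w)).eq a

theorem smul_smul_comm {n : ℕ} (v w : W n) (a : A n) : v • w • a = w • v • a :=
  DFunLike.congr_fun ((isDiag_actW v).commute (isDiag_actW w)).eq a

/-- The action factors through a commutative group of sign changes, so it only sees conjugacy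
classes. -/
theorem conj_smul {n : ℕ} (v w : W n) (a : A n) : (w * v * w⁻¹) • a = v • a := by
  rw [mul_smul, mul_smul, smul_smul_comm v, smul_inv_smul]

/-! ### Squares of involutions -/

/-- Conjugate elements act equally on `A`, but `y l` fixes `sq l` while every other generator
inverts it. -/
theorem conj_y_injective {n : ℕ} {v w : W n} {k l : Fin n}
    (h : v * y k * v⁻¹ = w * y l * w⁻¹) : k = l := by
  by_contra hkl
  have h1 := conj_smul (y k) v (sq l)
  rw [h, conj_smul, y_smul_sq_self, y_smul_sq_of_ne hkl] at h1
  exact sq_ne_inv l h1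

/-- Two conjugators differ by an element of the centralizer `{1, y k}`, which fixes `sq k`. This
makes `invSq` well defined. -/
theorem smul_sq_eq_of_conj {n : ℕ} {v w : W n} {k : Fin n}
    (h : v * y k * v⁻¹ = w * y k * w⁻¹) : v • sq k = w • sq k := by
  have hc : Commute (w⁻¹ * v) (y k) := by
    change w⁻¹ * v * y k = y k * (w⁻¹ * v)
    have := congrArg (fun g => w⁻¹ * g * v) h
    simpa [mul_assoc] using this
  have h1 : (w⁻¹ * v) • sq k = sq k := by
    rcases eq_one_or_eq_y_of_commute hc with h | h
    · rw [h, one_smul]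
    · rw [h, y_smul_sq_self]
  rw [mul_smul, inv_smul_eq_iff] at h1
  exact h1

open Classical in
/-- The element `w • x_k²` attached to the involution `w x̄_k w⁻¹`. -/
noncomputable def invSq {n : ℕ} (v : W n) : A n :=
  -- The value is the square of the lift `g x_k g⁻¹` of `v`, where `g` lifts `w`. The default `1`
  -- never matters: only conjugates of generators are used.
  if h : ∃ p : W n × Fin n, v = p.1 * y p.2 * p.1⁻¹ then h.choose.1 • sq h.choose.2 else 1

theorem invSq_conj_y {n : ℕ} (w : W n) (k : Fin n) : invSq (w * y k * w⁻¹) = w • sq k := by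
  have h : ∃ p : W n × Fin n, w * y k * w⁻¹ = p.1 * y p.2 * p.1⁻¹ := ⟨(w, k), rfl⟩
  rw [invSq, dif_pos h]
  have h2 := h.choose_spec
  have h3 := conj_y_injective h2
  rw [← h3] at h2 ⊢
  exact (smul_sq_eq_of_conj h2).symm

/-! ### The section of the projection from `Aut_S(A)` to `Aut(W)` -/

theorem exists_map_y {n : ℕ} (F : MulAut (W n)) (i : Fin n) :
    ∃ (w : W n) (k : Fin n), F (y i) = w * y k * w⁻¹ := by
  apply exists_conj_y
  · rw [Ne, map_eq_one_iff F F.injective]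
    exact y_ne_one i
  · rw [← map_mul, y_mul_y, map_one]

/-- The endomorphism of `A` induced by an automorphism of `W`. -/
noncomputable def autHom {n : ℕ} (F : MulAut (W n)) : A n →* A n :=
  liftA fun i => invSq (F (y i))

theorem autHom_sq {n : ℕ} (F : MulAut (W n)) (i : Fin n) :
    autHom F (sq i) = invSq (F (y i)) := liftA_sq _ i

theorem autHom_smul {n : ℕ} (F : MulAut (W n)) (w : W n) (a : A n) :
    autHom F (w • a) = F w • autHom F a := by
  have hw : w ∈ Subgroup.closure (Set.range (y : Fin n → W n)) := W_closure n ▸ trivial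
  have key : ∀ (j : Fin n) (a : A n), autHom F (y j • a) = F (y j) • autHom F a := by
    intro j a
    have : (autHom F).comp (MulDistribMulAction.toMonoidHom (A n) (y j)) =
        (MulDistribMulAction.toMonoidHom (A n) (F (y j))).comp (autHom F) := by
      apply homA_ext
      intro i
      simp only [MonoidHom.comp_apply, MulDistribMulAction.toMonoidHom_apply]
      obtain ⟨w, k, hw⟩ := exists_map_y F i
      obtain ⟨w', k', hw'⟩ := exists_map_y F j
      by_cases hij : j = i
      · subst hij
        rw [y_smul_sq_self, autHom_sq, hw, invSq_conj_y, conj_smul, smul_smul_comm,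
          y_smul_sq_self]
      -- If `F (y i)` and `F (y j)` were conjugate, applying `F⁻¹` would make `y i` and `y j`
      -- conjugate.
      · have hk : k' ≠ k := by
          rintro rfl
          apply hij
          have h1 : F (y j) = (w' * w⁻¹) * F (y i) * (w' * w⁻¹)⁻¹ := by
            rw [hw, hw']; group
          have h2 := congrArg F.symm h1
          simp only [map_mul, map_inv, MulEquiv.symm_apply_apply] at h2
          refine conj_y_injective (v := 1) (w := F.symm w' * (F.symm w)⁻¹) ?_
          simpa using h2
        rw [y_smul_sq_of_ne hij, map_inv, autHom_sq, hw, hw', invSq_conj_y, conj_smul,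
          smul_smul_comm, y_smul_sq_of_ne hk, smul_inv']
    exact DFunLike.congr_fun this a
  induction hw using Subgroup.closure_induction_left generalizing a with
  | one => simp
  | mul_left v hv w _ ih =>
    obtain ⟨i, rfl⟩ := hv
    rw [mul_smul, key, ih, map_mul, mul_smul]
  | inv_mul_cancel v hv w _ ih =>
    obtain ⟨i, rfl⟩ := hv
    rw [y_inv, mul_smul, key, ih, map_mul, mul_smul]

/-- If `F' (y i) = w * y k * w⁻¹`, then `F (F' (y i))` is the conjugate of `F (y k)` by `F w`, and
equivariance of `autHom F` produces the same factor `F w`. -/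
theorem autHom_mul {n : ℕ} (F F' : MulAut (W n)) :
    (autHom F).comp (autHom F') = autHom (F * F') := by
  apply homA_ext
  intro i
  obtain ⟨w, k, hw⟩ := exists_map_y F' i
  obtain ⟨v, l, hv⟩ := exists_map_y F k
  rw [MonoidHom.comp_apply, autHom_sq, autHom_sq, MulAut.mul_apply, hw, invSq_conj_y,
    autHom_smul, autHom_sq, map_mul, map_mul, map_inv, hv, invSq_conj_y, ← mul_smul,
    ← invSq_conj_y]
  congr 1
  group

theorem autHom_conj {n : ℕ} (w : W n) (a : A n) : autHom (MulAut.conj w) a = w • a := by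
  have : autHom (MulAut.conj w) = MulDistribMulAction.toMonoidHom (A n) w := by
    apply homA_ext
    intro i
    rw [autHom_sq, MulAut.conj_apply, invSq_conj_y]
    rfl
  exact DFunLike.congr_fun this a

theorem autHom_one (n : ℕ) : autHom (1 : MulAut (W n)) = MonoidHom.id _ := by
  ext1 a
  rw [← map_one MulAut.conj, autHom_conj, one_smul]
  rfl

/-- The section `Aut(W) → Aut_S(A)` of the projection. -/
noncomputable def autSection (n : ℕ) : MulAut (W n) →* AutS n where
  toFun F := ⟨(MonoidHom.toMulEquiv (autHom F) (autHom F⁻¹)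
    (by rw [autHom_mul, inv_mul_cancel, autHom_one])
    (by rw [autHom_mul, mul_inv_cancel, autHom_one]), F), autHom_smul F⟩
  map_one' := by
    apply Subtype.ext
    refine Prod.ext ?_ rfl
    ext1 a
    exact DFunLike.congr_fun (autHom_one n) a
  map_mul' F F' := by
    apply Subtype.ext
    refine Prod.ext ?_ rfl
    ext1 a
    exact (DFunLike.congr_fun (autHom_mul F F') a).symm

theorem autSection_conj {n : ℕ} (w : W n) : autSection n (MulAut.conj w) = wToAutS n w := by
  apply Subtype.ext
  refine Prod.ext ?_ rfl
  ext1 a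
  exact autHom_conj w a

/-! ### The map `κ` -/

theorem conj_mem_AutW {n : ℕ} (s : AutS n) {u : MulAut (A n)} (hu : u ∈ AutW n) :
    s.1.1 * u * s.1.1⁻¹ ∈ AutW n := by
  intro w a
  obtain ⟨w, rfl⟩ := s.1.2.surjective w
  obtain ⟨a, rfl⟩ := s.1.1.surjective a
  rw [← s.2]
  simp only [MulAut.mul_apply, MulAut.inv_apply_self]
  rw [hu, s.2]

theorem AutW_commute {n : ℕ} {u v : MulAut (A n)} (hu : u ∈ AutW n) (hv : v ∈ AutW n) :
    Commute u v := (mem_AutW_iff.1 hu).commute (mem_AutW_iff.1 hv)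

/-- The action of `Aut_S(A)` on `Aut_W(A)` by conjugation. -/
def conjAutW (n : ℕ) : AutS n →* MulAut (AutW n) where
  toFun s :=
    { toFun := fun u => ⟨s.1.1 * u * s.1.1⁻¹, conj_mem_AutW s u.2⟩
      invFun := fun u => ⟨s.1.1⁻¹ * u * s.1.1, by
        simpa using conj_mem_AutW s⁻¹ u.2⟩
      left_inv := fun u => Subtype.ext (by simp [mul_assoc])
      right_inv := fun u => Subtype.ext (by simp [mul_assoc])
      map_mul' := fun u v => Subtype.ext (by simp [mul_assoc]) }
  map_one' := by ext1 u; exact Subtype.ext (by simp)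
  map_mul' s t := by
    ext1 u
    exact Subtype.ext (by simp [mul_assoc])

theorem conjAutW_apply {n : ℕ} (s : AutS n) (u : AutW n) :
    (conjAutW n s u : MulAut (A n)) = s.1.1 * u * s.1.1⁻¹ := rfl

/-- The action of `Out(W)` on `Aut_W(A)`. -/
noncomputable def outAct (n : ℕ) : Out (W n) →* MulAut (AutW n) :=
  QuotientGroup.lift _ ((conjAutW n).comp (autSection n)) (by
    rintro _ ⟨w, rfl⟩
    ext1 u
    apply Subtype.ext
    rw [MonoidHom.comp_apply, autSection_conj, conjAutW_apply]
    change actW n w * u.1 * (actW n w)⁻¹ = u.1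
    rw [((isDiag_actW w).commute (mem_AutW_iff.1 u.2)).eq, mul_inv_cancel_right])

theorem fst_mem_AutW {n : ℕ} {s : AutS n} (h : s.1.2 = 1) : s.1.1 ∈ AutW n := by
  intro w a
  rw [s.2, h]
  rfl

/-- The `Aut_W(A)`-component of a semilinear automorphism. -/
noncomputable def linPart {n : ℕ} (s : AutS n) : AutW n :=
  ⟨(s * (autSection n s.1.2)⁻¹).1.1, fst_mem_AutW (mul_inv_cancel _)⟩

theorem linPart_mul_autSection {n : ℕ} (s : AutS n) :
    (linPart s).1 * (autSection n s.1.2).1.1 = s.1.1 :=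
  inv_mul_cancel_right (G := MulAut (A n)) _ _

/-- The action is defined through the section, but any other semilinear lift differs from it by an
element of the commutative group `AutW n`, which does not change the conjugation. -/
theorem outAct_apply {n : ℕ} (s : AutS n) (u : AutW n) :
    ((outAct n (s.1.2 : Out (W n)) u : AutW n) : MulAut (A n)) = s.1.1 * u * s.1.1⁻¹ := by
  change (autSection n s.1.2).1.1 * u.1 * (autSection n s.1.2).1.1⁻¹ = _
  have h := conj_mem_AutW (autSection n s.1.2) u.2
  have h2 := AutW_commute (linPart s).2 h
  rw [← linPart_mul_autSection s]
  rw [mul_inv_rev]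
  have h3 := congrArg (· * (linPart s).1⁻¹) h2.eq
  simp only [mul_inv_cancel_right] at h3
  rw [← h3]
  simp only [mul_assoc]

/-- The map `Aut_S(A) → Aut_W(A) ⋊ Out(W)`. -/
noncomputable def kappa (n : ℕ) : AutS n →* AutW n ⋊[outAct n] Out (W n) where
  toFun s := ⟨linPart s, (s.1.2 : Out (W n))⟩
  map_one' := by
    refine SemidirectProduct.ext ?_ rfl
    apply Subtype.ext
    change (1 : AutS n).1.1 * (autSection n 1).1.1⁻¹ = 1
    rw [map_one]
    simp
  map_mul' s t := by
    refine SemidirectProduct.ext ?_ rfl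
    apply Subtype.ext
    rw [SemidirectProduct.mul_left, Subgroup.coe_mul]
    change _ = (linPart s).1 * (outAct n ((autSection n s.1.2).1.2 : Out (W n)) (linPart t)).1
    rw [outAct_apply, ← mul_assoc, ← mul_assoc, linPart_mul_autSection]
    change s.1.1 * t.1.1 * (autSection n (s.1.2 * t.1.2)).1.1⁻¹ =
      s.1.1 * (t.1.1 * (autSection n t.1.2).1.1⁻¹) * _
    rw [map_mul, Subgroup.coe_mul, Prod.fst_mul, mul_inv_rev]
    simp only [mul_assoc]

theorem kappa_toAutS {n : ℕ} (u : AutW n) :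
    kappa n (AutW.toAutS n u) = SemidirectProduct.inl u := by
  refine SemidirectProduct.ext ?_ rfl
  apply Subtype.ext
  change u.1 * (autSection n 1).1.1⁻¹ = u.1
  rw [map_one]
  simp

theorem kappa_autSection {n : ℕ} (F : MulAut (W n)) :
    kappa n (autSection n F) = SemidirectProduct.inr (F : Out (W n)) := by
  refine SemidirectProduct.ext ?_ rfl
  apply Subtype.ext
  exact mul_inv_cancel (autSection n F).1.1

/-- Injectivity is triviality of the center of `W`. An element of the kernel has trivial linear part
and inner `W`-component, so it is the section at an inner automorphism, that is, the image of an
element of `W`. -/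
theorem shortExact_right_column {n : ℕ} (hn : 2 ≤ n) : ShortExact (wToAutS n) (kappa n) := by
  refine ⟨?_, ?_, ?_⟩
  · rw [injective_iff_map_eq_one]
    intro w hw
    apply eq_one_of_forall_commute hn
    intro k
    have h : MulAut.conj w (y k) = y k :=
      DFunLike.congr_fun (congrArg (fun s => s.1.2) hw) (y k)
    rw [MulAut.conj_apply, mul_inv_eq_iff_eq_mul] at h
    exact h
  · ext s
    rw [MonoidHom.mem_ker]
    constructor
    · rintro ⟨w, rfl⟩
      rw [← autSection_conj, kappa_autSection, (QuotientGroup.eq_one_iff (N := Inn (W n)) _).2 ⟨w, rfl⟩, map_one]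
    · intro h
      have h1 : linPart s = 1 := congrArg SemidirectProduct.left h
      obtain ⟨w, hw⟩ := (QuotientGroup.eq_one_iff _).1 (congrArg SemidirectProduct.right h)
      refine ⟨w, ?_⟩
      rw [← autSection_conj, hw]
      apply Subtype.ext
      refine Prod.ext ?_ rfl
      rw [← linPart_mul_autSection s, h1]
      rfl
  · rintro ⟨u, f⟩
    obtain ⟨F, rfl⟩ := QuotientGroup.mk_surjective f
    refine ⟨AutW.toAutS n u * autSection n F, ?_⟩
    rw [map_mul, kappa_toAutS, kappa_autSection]
    refine SemidirectProduct.ext ?_ ?_ <;> simp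

/-! ### Restriction of automorphisms of `G` -/

theorem mk_eq_one_iff {n : ℕ} {g : G n} : (g : W n) = 1 ↔ g ∈ A n := QuotientGroup.eq_one_iff g

theorem A_commute {n : ℕ} {a b : G n} (ha : a ∈ A n) (hb : b ∈ A n) : Commute a b :=
  congrArg Subtype.val (mul_comm (⟨a, ha⟩ : A n) ⟨b, hb⟩)

/-- For `n ≥ 3` the subgroup `A` is characteristic. -/
theorem map_mem_A {n : ℕ} (hn : 3 ≤ n) (φ : MulAut (G n)) {a : G n} (ha : a ∈ A n) :
    φ a ∈ A n := by
  rw [← mk_eq_one_iff]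
  apply eq_one_of_commute_conj hn
  intro k
  -- With `φ g = x k`, the conjugate of `φ a` by `x k` is the image of `g * a * g⁻¹`, which commutes
  -- with `a` because `A` is normal and abelian.
  obtain ⟨g, hg⟩ := φ.surjective (x k)
  have h1 : Commute a (g * a * g⁻¹) := A_commute ha ((A_normal n).conj_mem a ha g)
  have h2 : Commute (QuotientGroup.mk' (A n) (φ a)) (QuotientGroup.mk' (A n) (φ (g * a * g⁻¹))) :=
    (h1.map φ).map (QuotientGroup.mk' (A n))
  rw [map_mul φ, map_mul φ, map_inv φ, hg, map_mul, map_mul, map_inv] at h2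
  rw [show QuotientGroup.mk' (A n) (x k) = y k from rfl, y_inv] at h2
  exact h2

theorem map_A {n : ℕ} (hn : 3 ≤ n) (φ : MulAut (G n)) :
    (A n).map (φ : G n →* G n) = A n := by
  ext a
  constructor
  · rintro ⟨b, hb, rfl⟩
    exact map_mem_A hn φ hb
  · intro ha
    exact ⟨φ⁻¹ a, map_mem_A hn φ⁻¹ ha, MulAut.apply_inv_self (G n) φ a⟩

/-- The pair of automorphisms of `A` and `W` induced by an automorphism of `G`. -/
def restrict {n : ℕ} (hn : 3 ≤ n) : MulAut (G n) →* AutS n where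
  toFun φ := ⟨({ toFun := fun a => ⟨φ a, map_mem_A hn φ a.2⟩
                 invFun := fun a => ⟨φ⁻¹ a, map_mem_A hn φ⁻¹ a.2⟩
                 left_inv := fun a => Subtype.ext (MulAut.inv_apply_self (G n) φ a)
                 right_inv := fun a => Subtype.ext (MulAut.apply_inv_self (G n) φ a)
                 map_mul' := fun a b => Subtype.ext (map_mul φ _ _) },
      QuotientGroup.congr (A n) (A n) φ (map_A hn φ)), by
        intro w a
        obtain ⟨g, rfl⟩ := QuotientGroup.mk_surjective w
        apply Subtype.ext
        change φ (g * a * g⁻¹) = φ g * φ a * (φ g)⁻¹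
        simp⟩
  map_one' := by
    apply Subtype.ext
    refine Prod.ext rfl ?_
    ext1 w
    obtain ⟨g, rfl⟩ := QuotientGroup.mk_surjective w
    rfl
  map_mul' φ φ' := by
    apply Subtype.ext
    refine Prod.ext rfl ?_
    ext1 w
    obtain ⟨g, rfl⟩ := QuotientGroup.mk_surjective w
    rfl

theorem restrict_fst {n : ℕ} (hn : 3 ≤ n) (φ : MulAut (G n)) (a : A n) :
    (((restrict hn φ).1.1 a : A n) : G n) = φ a := rfl

theorem restrict_snd {n : ℕ} (hn : 3 ≤ n) (φ : MulAut (G n)) (g : G n) :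
    (restrict hn φ).1.2 (g : W n) = (φ g : W n) := rfl

theorem restrict_comp_conj {n : ℕ} (hn : 3 ≤ n) :
    (restrict hn).comp MulAut.conj = (wToAutS n).comp (QuotientGroup.mk' (A n)) := by
  ext1 g
  apply Subtype.ext
  refine Prod.ext rfl ?_
  ext1 w
  obtain ⟨h, rfl⟩ := QuotientGroup.mk_surjective w
  rfl

/-- A semilinear automorphism lifts to `G` as soon as the images of the generators can be
lifted compatibly with squares. -/
theorem exists_restrict_eq {n : ℕ} (hn : 3 ≤ n) (s : AutS n) (g : Fin n → G n)
    (hg : ∀ i, (g i : W n) = s.1.2 (y i)) (hg2 : ∀ i, g i ^ 2 = (s.1.1 (sq i) : A n)) :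
    ∃ φ, restrict hn φ = s := by
  have hrel : ∀ i j, i ≠ j → (g i)⁻¹ * g j ^ 2 * g i = (g j ^ 2)⁻¹ := by
    intro i j hij
    -- The defining relation says that `y i` inverts `sq j`; semilinearity transports this to the
    -- images.
    have h1 : (s.1.2 (y i))⁻¹ • s.1.1 (sq j) = (s.1.1 (sq j))⁻¹ := by
      rw [← map_inv, ← s.2, y_inv, y_smul_sq_of_ne hij, map_inv]
    rw [← hg] at h1
    have h2 := congrArg Subtype.val h1
    rw [← QuotientGroup.mk_inv, coe_mk_smul, ← hg2, inv_inv, InvMemClass.coe_inv, ← hg2] at h2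
    exact h2
  let φ : G n →* G n := liftG g hrel
  have hA : ∀ a : A n, φ a = (s.1.1 a : A n) := by
    have : φ.comp (A n).subtype = (A n).subtype.comp s.1.1.toMonoidHom := by
      apply homA_ext
      intro i
      change φ (x i ^ 2) = _
      rw [map_pow, liftG_x, hg2]
      rfl
    exact fun a => DFunLike.congr_fun this a
  have hW : ∀ h : G n, (φ h : W n) = s.1.2 (h : W n) := by
    have : (QuotientGroup.mk' (A n)).comp φ =
        s.1.2.toMonoidHom.comp (QuotientGroup.mk' (A n)) := by
      apply homG_ext
      intro i
      change ((φ (x i) : G n) : W n) = _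
      rw [liftG_x, hg]
      rfl
    exact fun a => DFunLike.congr_fun this a
  have hinj : Function.Injective φ := by
    rw [injective_iff_map_eq_one]
    intro h hh
    have h1 := hW h
    rw [hh, QuotientGroup.mk_one, eq_comm, map_eq_one_iff _ s.1.2.injective,
      mk_eq_one_iff] at h1
    have h2 := hA ⟨h, h1⟩
    rw [hh, eq_comm, OneMemClass.coe_eq_one, map_eq_one_iff _ s.1.1.injective] at h2
    exact congrArg Subtype.val h2
  have hsurj : Function.Surjective φ := by
    intro b
    obtain ⟨w, hw⟩ := s.1.2.surjective (b : W n)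
    obtain ⟨h, rfl⟩ := QuotientGroup.mk_surjective w
    rw [← hW, QuotientGroup.eq] at hw
    obtain ⟨a, ha⟩ := s.1.1.surjective ⟨_, hw⟩
    refine ⟨h * a, ?_⟩
    rw [map_mul, hA, ha, mul_inv_cancel_left]
  refine ⟨MulEquiv.ofBijective φ ⟨hinj, hsurj⟩, ?_⟩
  apply Subtype.ext
  refine Prod.ext ?_ ?_
  · ext1 a
    exact Subtype.ext (hA a)
  · ext1 w
    obtain ⟨h, rfl⟩ := QuotientGroup.mk_surjective w
    exact hW h

/-- The image of `y i` is the class of some `g x_k g⁻¹`, and `sq i` must go to `g • sq k` up to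
sign. Replacing `x_k` by `x_k⁻¹` changes the sign of the square but not the class in `W`. -/
theorem restrict_surjective {n : ℕ} (hn : 3 ≤ n) : Function.Surjective (restrict hn) := by
  intro s
  have key : ∀ i, ∃ g : G n, (g : W n) = s.1.2 (y i) ∧ g ^ 2 = (s.1.1 (sq i) : A n) := by
    intro i
    obtain ⟨w, k, hw⟩ := exists_map_y s.1.2 i
    obtain ⟨g, rfl⟩ := QuotientGroup.mk_surjective w
    have h1 : s.1.1 (sq i) = (linPart s).1 ((g : W n) • sq k) := by
      rw [← linPart_mul_autSection s, MulAut.mul_apply, ← invSq_conj_y, ← hw]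
      exact congrArg _ (autHom_sq _ i)
    rw [(linPart s).2] at h1
    rcases mem_AutW_iff.1 (linPart s).2 k with h | h
    · refine ⟨g * x k * g⁻¹, hw.symm, ?_⟩
      rw [h1, h, coe_mk_smul, conj_pow]
      rfl
    · refine ⟨g * (x k)⁻¹ * g⁻¹, ?_, ?_⟩
      · rw [hw, ← y_inv]; rfl
      · rw [h1, h, coe_mk_smul, conj_pow, inv_pow]
        rfl
  choose g hg hg2 using key
  exact exists_restrict_eq hn s g hg hg2

/-! ### Automorphisms attached to matrices -/

/-- A zero `i`-th coordinate means that `x i` inverts `a`, so `a * x i * a = x i`. This is the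
origin of the zero diagonal in `M_0`. -/
theorem mul_monomial_sq {n : ℕ} {i : Fin n} {a : A n} (h : coord a i = 0) :
    (x i * (a : G n)) ^ 2 = x i ^ 2 := by
  have h1 := congrArg Subtype.val (y_smul_eq_inv_iff.2 h)
  rw [show y i = ((x i : G n) : W n) from rfl, coe_mk_smul] at h1
  rw [mul_inv_eq_iff_eq_mul] at h1
  rw [pow_two, pow_two, mul_assoc, ← mul_assoc (a : G n)]
  have h2 : (a : G n) * x i * a = x i := by
    have : (a : G n) * (x i * a) = x i := by
      rw [h1, InvMemClass.coe_inv, mul_inv_cancel_left]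
    rwa [mul_assoc]
  rw [h2]

/-- The endomorphism `x_i ↦ x_i (x_1²)^{m_i1} ⋯ (x_n²)^{m_in}` of `G`. -/
def matHom {n : ℕ} (m : M0 n) : G n →* G n :=
  liftG (fun i => x i * (monomial (m.1 i) : G n)) (by
    intro i j hij
    have hj : coord (monomial (m.1 j)) j = 0 := by rw [coord_monomial]; exact m.2 j
    simp only [mul_monomial_sq hj]
    have hc : Commute (monomial (m.1 i) : G n) (x j ^ 2)⁻¹ :=
      A_commute (SetLike.coe_mem _) (inv_mem (sq_mem j))
    rw [mul_inv_rev, mul_assoc, mul_assoc, ← mul_assoc (x j ^ 2), ← mul_assoc (x i)⁻¹,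
      ← mul_assoc (x i)⁻¹, rel hij, ← hc.eq, inv_mul_cancel_left])

theorem matHom_x {n : ℕ} (m : M0 n) (i : Fin n) :
    matHom m (x i) = x i * (monomial (m.1 i) : G n) := liftG_x _ _ i

theorem matHom_coe {n : ℕ} (m : M0 n) (a : A n) : matHom m a = a := by
  have : (matHom m).comp (A n).subtype = (A n).subtype := by
    apply homA_ext
    intro i
    change matHom m (x i ^ 2) = x i ^ 2
    rw [map_pow, matHom_x, mul_monomial_sq]
    rw [coord_monomial]
    exact m.2 i
  exact DFunLike.congr_fun this a

theorem mk_matHom {n : ℕ} (m : M0 n) (g : G n) : (matHom m g : W n) = g := by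
  have : (QuotientGroup.mk' (A n)).comp (matHom m) = QuotientGroup.mk' (A n) := by
    apply homG_ext
    intro i
    rw [MonoidHom.comp_apply, matHom_x, map_mul]
    simp
  exact DFunLike.congr_fun this g

/-- The map of `m` fixes `A` pointwise, so the factor contributed by `m'` passes through unchanged
and the exponents add. -/
theorem matHom_add {n : ℕ} (m m' : M0 n) :
    matHom (m + m') = (matHom m).comp (matHom m') := by
  apply homG_ext
  intro i
  rw [MonoidHom.comp_apply, matHom_x, matHom_x, map_mul, matHom_coe, matHom_x, mul_assoc,
    ← Subgroup.coe_mul, ← monomial_add]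
  rfl

theorem matHom_zero (n : ℕ) : matHom (0 : M0 n) = MonoidHom.id _ := by
  apply homG_ext
  intro i
  rw [matHom_x]
  simp [monomial]

/-- The homomorphism `M_0 → Aut(G)`. -/
def matAut (n : ℕ) : Multiplicative (M0 n) →* MulAut (G n) where
  toFun m := MonoidHom.toMulEquiv (matHom m.toAdd) (matHom (-m.toAdd))
    (by rw [← matHom_add, neg_add_cancel, matHom_zero])
    (by rw [← matHom_add, add_neg_cancel, matHom_zero])
  map_one' := by
    ext1 g
    exact DFunLike.congr_fun (matHom_zero n) g
  map_mul' m m' := by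
    ext1 g
    exact DFunLike.congr_fun (matHom_add m.toAdd m'.toAdd) g

/-- Automorphisms inducing the identity on `A` and `W` come from matrices. -/
theorem exists_matHom_eq {n : ℕ} (φ : G n →* G n) (hA : ∀ a : A n, φ a = a)
    (hW : ∀ g : G n, (φ g : W n) = g) : ∃ m : M0 n, matHom m = φ := by
  have h : ∀ i, ∃ a : A n, φ (x i) = x i * a := fun i =>
    ⟨⟨(x i)⁻¹ * φ (x i), QuotientGroup.eq.1 (hW (x i)).symm⟩, (mul_inv_cancel_left _ _).symm⟩
  choose a ha using h
  -- Since `φ` fixes `x i ^ 2`, the identity `(x i * a i) ^ 2 = x i ^ 2` says that `y i` inverts `a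
  -- i`.
  have h0 : ∀ i, coord (a i) i = 0 := by
    intro i
    rw [← y_smul_eq_inv_iff]
    apply Subtype.ext
    rw [show y i = ((x i : G n) : W n) from rfl, coe_mk_smul, InvMemClass.coe_inv,
      mul_inv_eq_iff_eq_mul, eq_inv_mul_iff_mul_eq]
    have h1 := hA (sq i)
    change φ (x i ^ 2) = x i ^ 2 at h1
    rw [map_pow, ha, pow_two, pow_two, mul_assoc] at h1
    exact mul_left_cancel h1
  refine ⟨⟨fun i => coord (a i), h0⟩, ?_⟩
  apply homG_ext
  intro i
  rw [matHom_x, ha, monomial_coord]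

theorem matHom_injective {n : ℕ} : Function.Injective (matHom : M0 n → G n →* G n) := by
  intro m m' h
  apply Subtype.ext
  funext i
  have h1 := DFunLike.congr_fun h (x i)
  rw [matHom_x, matHom_x] at h1
  exact monomial_injective (Subtype.ext (mul_left_cancel h1))

theorem shortExact_middle_row {n : ℕ} (hn : 3 ≤ n) :
    ShortExact (matAut n) (restrict hn) := by
  refine ⟨?_, ?_, restrict_surjective hn⟩
  · intro m m' h
    exact matHom_injective (MonoidHom.ext fun g => DFunLike.congr_fun h g)
  · ext φ
    rw [MonoidHom.mem_ker]
    constructor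
    · rintro ⟨m, rfl⟩
      apply Subtype.ext
      refine Prod.ext ?_ ?_
      · ext1 a
        exact Subtype.ext (matHom_coe _ a)
      · ext1 w
        obtain ⟨g, rfl⟩ := QuotientGroup.mk_surjective w
        exact mk_matHom _ g
    · intro h
      obtain ⟨m, hm⟩ := exists_matHom_eq φ.toMonoidHom
        (fun a => congrArg Subtype.val (DFunLike.congr_fun (congrArg (fun s => s.1.1) h) a))
        (fun g => DFunLike.congr_fun (congrArg (fun s => s.1.2) h) (g : W n))
      exact ⟨Multiplicative.ofAdd m, MulEquiv.ext fun g => DFunLike.congr_fun hm g⟩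

/-- A central element of `G` maps to the trivial center of `W`, so it lies in `A` and is fixed by
every `y i`. Each coordinate is negated by some `y i`, hence is zero. -/
theorem conj_injective {n : ℕ} (hn : 2 ≤ n) :
    Function.Injective (MulAut.conj : G n →* MulAut (G n)) := by
  rw [injective_iff_map_eq_one]
  intro g hg
  have hc : ∀ k, g * x k = x k * g := fun k =>
    mul_inv_eq_iff_eq_mul.1 (DFunLike.congr_fun hg (x k))
  have hgA : g ∈ A n := by
    rw [← mk_eq_one_iff]
    exact eq_one_of_forall_commute hn fun k =>
      congrArg (QuotientGroup.mk' (A n)) (hc k)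
  have hfix : ∀ k, y k • (⟨g, hgA⟩ : A n) = ⟨g, hgA⟩ := fun k =>
    Subtype.ext (mul_inv_eq_iff_eq_mul.2 (hc k).symm)
  have hz : (⟨g, hgA⟩ : A n) = 1 := by
    apply coord_injective
    funext j
    obtain ⟨i, hi⟩ : ∃ i : Fin n, i ≠ j := by
      have : Nontrivial (Fin n) := Fin.nontrivial_iff_two_le.2 hn
      exact exists_ne j
    have := congrFun (congrArg coord (hfix i)) j
    rw [coord_y_smul, if_neg hi] at this
    rw [coord_one, Pi.zero_apply]
    omega
  exact congrArg Subtype.val hz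

/-! ### The left column -/

/-- The homomorphism `A → M_0` corresponding to inner automorphisms. -/
noncomputable def iota (n : ℕ) : A n →* Multiplicative (M0 n) where
  toFun a := Multiplicative.ofAdd
    ⟨Matrix.of fun i k => if i = k then 0 else -2 * coord a k, fun i => by simp⟩
  map_one' := by
    apply Multiplicative.toAdd.injective
    apply Subtype.ext
    ext i k
    simp
  map_mul' a b := by
    apply Multiplicative.toAdd.injective
    apply Subtype.ext
    ext i k
    by_cases h : i = k
    · simp [h]
    · simp [h]; ring

theorem iota_apply {n : ℕ} (a : A n) (i k : Fin n) :
    ((iota n a).toAdd).1 i k = if i = k then 0 else -2 * coord a k := rfl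

/-- One has `a x_i a⁻¹ = x_i · (x_i⁻¹ a x_i) a⁻¹`, and `y i • a * a⁻¹` has `i`-th coordinate `0` and
the others multiplied by `-2`. -/
theorem matAut_comp_iota (n : ℕ) :
    (matAut n).comp (iota n) = MulAut.conj.comp (A n).subtype := by
  ext1 a
  apply MulEquiv.toMonoidHom_injective
  apply homG_ext
  intro i
  change matHom (iota n a).toAdd (x i) = a * x i * (a : G n)⁻¹
  have h1 : monomial (((iota n a).toAdd).1 i) = y i • a * a⁻¹ := by
    apply coord_injective
    rw [coord_monomial]
    funext k
    rw [iota_apply, coord_mul, coord_inv, Pi.add_apply, coord_y_smul, Pi.neg_apply]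
    split_ifs <;> ring
  rw [matHom_x, h1, ← y_inv]
  rw [show (y i)⁻¹ = (((x i)⁻¹ : G n) : W n) from rfl, Subgroup.coe_mul, coe_mk_smul]
  simp [mul_assoc]

theorem iota_injective {n : ℕ} (hn : 2 ≤ n) : Function.Injective (iota n) := by
  intro a b h
  have h1 := DFunLike.congr_fun (matAut_comp_iota n) a
  have h2 := DFunLike.congr_fun (matAut_comp_iota n) b
  rw [MonoidHom.comp_apply] at h1 h2
  rw [h, h2] at h1
  exact Subtype.ext (conj_injective hn h1.symm)

theorem matHom_mul_inv_mem {n : ℕ} (m : M0 n) (g : G n) : matHom m g * g⁻¹ ∈ A n := by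
  rw [← mk_eq_one_iff, QuotientGroup.mk_mul, mk_matHom, ← QuotientGroup.mk_mul,
    mul_inv_cancel, QuotientGroup.mk_one]

/-- The function `ḡ ↦ t_m(g) g⁻¹`. -/
noncomputable def matFun {n : ℕ} (m : M0 n) (w : W n) : A n :=
  ⟨matHom m w.out * w.out⁻¹, matHom_mul_inv_mem m _⟩

/-- The choice of representative is immaterial, because `matHom m` fixes `A` pointwise. -/
theorem matFun_mk {n : ℕ} (m : M0 n) (g : G n) : (matFun m (g : W n) : G n) = matHom m g * g⁻¹ := by
  obtain ⟨a, ha⟩ := QuotientGroup.mk_out_eq_mul (A n) g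
  change matHom m (g : W n).out * (g : W n).out⁻¹ = _
  rw [ha, map_mul, matHom_coe, mul_inv_rev, mul_assoc, mul_inv_cancel_left]

theorem matFun_mul {n : ℕ} (m : M0 n) (v w : W n) :
    matFun m (v * w) = v • matFun m w * matFun m v := by
  obtain ⟨g, rfl⟩ := QuotientGroup.mk_surjective v
  obtain ⟨h, rfl⟩ := QuotientGroup.mk_surjective w
  rw [mul_comm]
  apply Subtype.ext
  rw [← QuotientGroup.mk_mul, matFun_mk, Subgroup.coe_mul, coe_mk_smul, matFun_mk, matFun_mk,
    map_mul]
  group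

theorem matFun_add {n : ℕ} (m m' : M0 n) (w : W n) :
    matFun (m + m') w = matFun m w * matFun m' w := by
  obtain ⟨g, rfl⟩ := QuotientGroup.mk_surjective w
  rw [mul_comm]
  apply Subtype.ext
  have h : matHom m' g = matFun m' (g : W n) * g := by rw [matFun_mk, inv_mul_cancel_right]
  rw [matFun_mk, Subgroup.coe_mul, matHom_add, MonoidHom.comp_apply, h, map_mul, matHom_coe,
    matFun_mk m g, mul_assoc]

/-- The cocycle attached to a matrix. -/
noncomputable def matCocycle (n : ℕ) : M0 n →+ groupCohomology.cocycles₁ (repA n) where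
  toFun m := ⟨fun w => Additive.ofMul (matFun m w),
    (groupCohomology.mem_cocycles₁_iff (A := repA n) _).2 fun v w => matFun_mul m v w⟩
  map_zero' := by
    apply groupCohomology.cocycles₁_ext
    intro w
    change matFun 0 w = 1
    obtain ⟨g, rfl⟩ := QuotientGroup.mk_surjective w
    apply Subtype.ext
    rw [matFun_mk, matHom_zero]
    simp
  map_add' m m' := by
    apply groupCohomology.cocycles₁_ext
    exact matFun_add m m'

/-- A cocycle `f` gives back the endomorphism `g ↦ f(ḡ) g`. It is trivial on `W`, and on `A` because
`f 1 = 1`, so it comes from a matrix. -/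
theorem matCocycle_surjective (n : ℕ) : Function.Surjective (matCocycle n) := by
  intro c
  let f : W n → A n := fun w => Additive.toMul (c w)
  have hf : ∀ v w, f (v * w) = v • f w * f v :=
    (groupCohomology.mem_cocycles₁_iff (A := repA n) _).1 c.2
  have hf1 : f 1 = 1 := groupCohomology.cocycles₁_map_one c
  let φ : G n →* G n := MonoidHom.mk' (fun g => f (g : W n) * g) (by
    intro g h
    rw [QuotientGroup.mk_mul, hf, mul_comm, Subgroup.coe_mul, coe_mk_smul]
    group)
  obtain ⟨m, hm⟩ := exists_matHom_eq φ
    (fun a => by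
      change (f ((a : G n) : W n) : G n) * a = a
      rw [mk_eq_one_iff.2 a.2, hf1]
      simp)
    (fun g => by
      change ((f (g : W n) * g : G n) : W n) = g
      rw [QuotientGroup.mk_mul, mk_eq_one_iff.2 (SetLike.coe_mem _), one_mul])
  refine ⟨m, ?_⟩
  apply groupCohomology.cocycles₁_ext
  intro w
  obtain ⟨g, rfl⟩ := QuotientGroup.mk_surjective w
  change matFun m (g : W n) = f g
  apply Subtype.ext
  rw [matFun_mk, hm]
  exact mul_inv_cancel_right _ _

/-- The homomorphism `M_0 → H¹(W, A)`. -/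
noncomputable def toH1 (n : ℕ) : Multiplicative (M0 n) →* Multiplicative (H1 n) :=
  AddMonoidHom.toMultiplicative
    ((groupCohomology.H1π (repA n)).hom.toAddMonoidHom.comp (matCocycle n))

theorem toH1_apply {n : ℕ} (m : Multiplicative (M0 n)) :
    toH1 n m = Multiplicative.ofAdd (groupCohomology.H1π (repA n) (matCocycle n m.toAdd)) := rfl

/-- The automorphism `t_m` is conjugation by `a` exactly when its cocycle is `g ↦ a * g • a⁻¹`, the
coboundary of `a⁻¹`; hence the inverses in the witnesses. -/
theorem toH1_eq_one_iff {n : ℕ} (m : Multiplicative (M0 n)) :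
    toH1 n m = 1 ↔ ∃ a, iota n a = m := by
  have h0 : toH1 n m = 1 ↔ groupCohomology.H1π (repA n) (matCocycle n m.toAdd) = 0 := Iff.rfl
  rw [h0, groupCohomology.H1π_eq_zero_iff]
  have h1 : ∀ a : A n, iota n a = m ↔ ∀ g : G n, matFun m.toAdd (g : W n) = a * (g : W n) • a⁻¹ := by
    intro a
    have h2 : iota n a = m ↔ ∀ g, matHom m.toAdd g = a * g * (a : G n)⁻¹ := by
      rw [← (matHom_injective (n := n)).eq_iff (a := (iota n a).toAdd) (b := m.toAdd)
        |>.trans Multiplicative.toAdd.injective.eq_iff, DFunLike.ext_iff]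
      refine forall_congr' fun g => ?_
      have h3 := DFunLike.congr_fun (DFunLike.congr_fun (matAut_comp_iota n) a) g
      change matHom (iota n a).toAdd g = a * g * (a : G n)⁻¹ at h3
      rw [h3, eq_comm]
    rw [h2]
    refine forall_congr' fun g => ?_
    rw [← Subtype.coe_inj, matFun_mk, Subgroup.coe_mul, coe_mk_smul, mul_inv_eq_iff_eq_mul,
      InvMemClass.coe_inv]
    simp [mul_assoc]
  constructor
  · rintro ⟨a, ha⟩
    refine ⟨(Additive.toMul a : A n)⁻¹, (h1 _).2 fun g => ?_⟩
    have := congrFun ha (g : W n)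
    rw [inv_inv, mul_comm, ← div_eq_mul_inv]
    exact this.symm
  · rintro ⟨a, ha⟩
    refine ⟨(Additive.ofMul a⁻¹ : Additive (A n)), ?_⟩
    funext w
    obtain ⟨g, rfl⟩ := QuotientGroup.mk_surjective w
    have := (h1 a).1 ha g
    rw [mul_comm, ← inv_inv a, inv_inv a⁻¹, ← div_eq_mul_inv] at this
    exact this.symm

theorem shortExact_left_column {n : ℕ} (hn : 2 ≤ n) : ShortExact (iota n) (toH1 n) := by
  refine ⟨iota_injective hn, ?_, ?_⟩
  · ext m
    rw [MonoidHom.mem_ker, toH1_eq_one_iff]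
    rfl
  · intro h
    induction h with | ofAdd h
    induction h using groupCohomology.H1_induction_on with
    | h c =>
      obtain ⟨m, rfl⟩ := matCocycle_surjective n c
      exact ⟨Multiplicative.ofAdd m, rfl⟩

/-! ### The bottom row -/

/-- The last row of a `3 × 3` diagram with exact columns and exact upper rows is exact. -/
theorem shortExact_bottom_row {A₁ G₁ W₁ A₂ G₂ W₂ A₃ G₃ W₃ : Type*} [Group A₁] [Group G₁]
    [Group W₁] [Group A₂] [Group G₂] [Group W₂] [Group A₃] [Group G₃] [Group W₃]
    {i₁ : A₁ →* G₁} {p₁ : G₁ →* W₁} {i₂ : A₂ →* G₂} {p₂ : G₂ →* W₂}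
    {i₃ : A₃ →* G₃} {p₃ : G₃ →* W₃} {a : A₁ →* A₂} {a' : A₂ →* A₃} {b : G₁ →* G₂}
    {b' : G₂ →* G₃} {c : W₁ →* W₂} {c' : W₂ →* W₃}
    (h₁ : ShortExact i₁ p₁) (h₂ : ShortExact i₂ p₂)
    (ha : ShortExact a a') (hb : ShortExact b b') (hc : ShortExact c c')
    (sq₁ : i₂.comp a = b.comp i₁) (sq₂ : p₂.comp b = c.comp p₁)
    (sq₃ : i₃.comp a' = b'.comp i₂) (sq₄ : p₃.comp b' = c'.comp p₂) :
    ShortExact i₃ p₃ := by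
  have s₁ := DFunLike.congr_fun sq₁
  have s₂ := DFunLike.congr_fun sq₂
  have s₃ := DFunLike.congr_fun sq₃
  have s₄ := DFunLike.congr_fun sq₄
  simp only [MonoidHom.comp_apply] at s₁ s₂ s₃ s₄
  have e₁ : ∀ g, p₁ g = 1 ↔ ∃ y, i₁ y = g := fun g => (SetLike.ext_iff.1 h₁.2.1 g).symm
  have e₂ : ∀ g, p₂ g = 1 ↔ ∃ y, i₂ y = g := fun g => (SetLike.ext_iff.1 h₂.2.1 g).symm
  have ea : ∀ g, a' g = 1 ↔ ∃ y, a y = g := fun g => (SetLike.ext_iff.1 ha.2.1 g).symm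
  have eb : ∀ g, b' g = 1 ↔ ∃ y, b y = g := fun g => (SetLike.ext_iff.1 hb.2.1 g).symm
  have ec : ∀ g, c' g = 1 ↔ ∃ y, c y = g := fun g => (SetLike.ext_iff.1 hc.2.1 g).symm
  refine ⟨?_, ?_, ?_⟩
  · rw [injective_iff_map_eq_one]
    intro z hz
    obtain ⟨m, rfl⟩ := ha.2.2 z
    rw [s₃, eb] at hz
    obtain ⟨g, hg⟩ := hz
    have h : p₁ g = 1 := by
      rw [← map_eq_one_iff c hc.1, ← s₂, hg, e₂]
      exact ⟨m, rfl⟩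
    obtain ⟨y, rfl⟩ := (e₁ g).1 h
    rw [← s₁] at hg
    exact (ea m).2 ⟨y, h₂.1 hg⟩
  · ext o
    rw [MonoidHom.mem_ker]
    constructor
    · rintro ⟨z, rfl⟩
      obtain ⟨m, rfl⟩ := ha.2.2 z
      rw [s₃, s₄, (e₂ _).2 ⟨m, rfl⟩, map_one]
    · intro ho
      obtain ⟨φ, rfl⟩ := hb.2.2 o
      rw [s₄, ec] at ho
      obtain ⟨w, hw⟩ := ho
      obtain ⟨g, rfl⟩ := h₁.2.2 w
      -- Dividing by `b g` does not change the class under `b'` and moves `φ` into the kernel of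
      -- `p₂`.
      obtain ⟨m, hm⟩ := (e₂ ((b g)⁻¹ * φ)).1 (by
        rw [map_mul, map_inv, s₂, hw, inv_mul_cancel])
      refine ⟨a' m, ?_⟩
      rw [s₃, hm, map_mul, map_inv, (eb _).2 ⟨g, rfl⟩, inv_one, one_mul]
  · intro k
    obtain ⟨s, rfl⟩ := hc.2.2 k
    obtain ⟨φ, rfl⟩ := h₂.2.2 s
    exact ⟨b' φ, s₄ φ⟩

theorem ShortExact.comp_mulEquiv {X X' Y Z Z' : Type*} [Group X] [Group X'] [Group Y] [Group Z]
    [Group Z'] {f : X →* Y} {g : Y →* Z} (h : ShortExact f g) (e : X' ≃* X) (e' : Z ≃* Z') :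
    ShortExact (f.comp e.toMonoidHom) (e'.toMonoidHom.comp g) := by
  refine ⟨h.1.comp e.injective, ?_, e'.surjective.comp h.2.2⟩
  rw [MonoidHom.range_comp, MonoidHom.range_eq_top.2 e.surjective, ← MonoidHom.range_eq_map,
    h.2.1]
  ext y
  exact (map_eq_one_iff e' e'.injective).symm

theorem shortExact_mk {H : Type*} [Group H] (N : Subgroup H) [N.Normal] :
    N.subtype.range = (QuotientGroup.mk' N).ker ∧ Function.Surjective (QuotientGroup.mk' N) :=
  ⟨by rw [Subgroup.range_subtype, QuotientGroup.ker_mk'], QuotientGroup.mk'_surjective N⟩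

/-- The homomorphism `H¹(W, A) → Out(G)`. -/
noncomputable def outOfH1 {n : ℕ} (hn : 2 ≤ n) : Multiplicative (H1 n) →* Out (G n) :=
  (toH1 n).liftOfSurjective (shortExact_left_column hn).2.2
    ⟨(QuotientGroup.mk' (Inn (G n))).comp (matAut n), by
      rw [← (shortExact_left_column hn).2.1]
      rintro _ ⟨a, rfl⟩
      have := DFunLike.congr_fun (matAut_comp_iota n) a
      rw [MonoidHom.comp_apply] at this
      rw [MonoidHom.mem_ker, MonoidHom.comp_apply, this]
      exact (QuotientGroup.eq_one_iff (N := Inn (G n)) _).2 ⟨a, rfl⟩⟩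

theorem outOfH1_comp {n : ℕ} (hn : 2 ≤ n) :
    (outOfH1 hn).comp (toH1 n) = (QuotientGroup.mk' (Inn (G n))).comp (matAut n) :=
  MonoidHom.liftOfRightInverse_comp _ _ _ _

/-- The homomorphism `Out(G) → Aut_W(A) ⋊ Out(W)`. -/
noncomputable def outRestrict {n : ℕ} (hn : 3 ≤ n) :
    Out (G n) →* AutW n ⋊[outAct n] Out (W n) :=
  QuotientGroup.lift _ ((kappa n).comp (restrict hn)) (by
    rintro _ ⟨g, rfl⟩
    have := DFunLike.congr_fun (restrict_comp_conj hn) g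
    rw [MonoidHom.comp_apply] at this
    rw [MonoidHom.mem_ker, MonoidHom.comp_apply, this, ← MonoidHom.mem_ker,
      ← (shortExact_right_column (by omega)).2.1]
    exact ⟨_, rfl⟩)

theorem outRestrict_comp {n : ℕ} (hn : 3 ≤ n) :
    (outRestrict hn).comp (QuotientGroup.mk' (Inn (G n))) = (kappa n).comp (restrict hn) := rfl

/-! ### The isomorphism types -/

/-- The homomorphism from `M_0` to `ℤ^{n(n-2)} × (ℤ/2)^n`, `n = m + 2`: in each column it records
the differences of the off-diagonal entries and the parity of the first of them. -/
def matInvariants (m : ℕ) :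
    M0 (m + 2) →+ (Fin ((m + 2) * m) → ℤ) × (Fin (m + 2) → ZMod 2) where
  toFun M := (fun r => M.1 ((finProdFinEquiv.symm r).1.succAbove (finProdFinEquiv.symm r).2.succ)
      (finProdFinEquiv.symm r).1 - M.1 ((finProdFinEquiv.symm r).1.succAbove 0)
      (finProdFinEquiv.symm r).1, fun k => (M.1 (k.succAbove 0) k : ZMod 2))
  map_zero' := by
    refine Prod.ext ?_ ?_ <;> funext r <;> simp
  map_add' M N := by
    refine Prod.ext ?_ ?_ <;> funext r
    · simp; ring
    · simp

theorem matInvariants_surjective (m : ℕ) : Function.Surjective (matInvariants m) := by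
  rintro ⟨f, g⟩
  -- Column `k` has `0` on the diagonal, a lift of the prescribed parity as first remaining entry,
  -- and that lift plus the prescribed differences below.
  refine ⟨⟨Matrix.of fun i k => Fin.insertNth (α := fun _ => ℤ) k 0 (Fin.cons (g k).val
    fun l => f (finProdFinEquiv (k, l)) + (g k).val) i, fun i => by simp⟩, ?_⟩
  refine Prod.ext ?_ ?_ <;> funext r
  · obtain ⟨p, rfl⟩ := finProdFinEquiv.surjective r
    simp only [matInvariants, AddMonoidHom.coe_mk, ZeroHom.coe_mk, Equiv.symm_apply_apply]
    simp
  · simp [matInvariants]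

/-- Both conditions say that every column is constant and even off the diagonal. Thus
`matInvariants` and `toH1` are surjections from `M_0` with the same kernel, which identifies their
targets. -/
theorem matInvariants_eq_zero_iff {m : ℕ} (M : M0 (m + 2)) :
    matInvariants m M = 0 ↔ ∃ a, iota (m + 2) a = Multiplicative.ofAdd M := by
  constructor
  · intro h
    have h1 : ∀ (k : Fin (m + 2)) (l : Fin m),
        M.1 (k.succAbove l.succ) k = M.1 (k.succAbove 0) k := by
      intro k l
      have := congrFun (congrArg Prod.fst h) (finProdFinEquiv (k, l))
      simp only [matInvariants, AddMonoidHom.coe_mk, ZeroHom.coe_mk,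
        Equiv.symm_apply_apply] at this
      exact sub_eq_zero.1 this
    have h2 : ∀ k : Fin (m + 2), ∃ z : ℤ, M.1 (k.succAbove 0) k = 2 * z := fun k =>
      (ZMod.intCast_zmod_eq_zero_iff_dvd _ 2).1 (congrFun (congrArg Prod.snd h) k)
    choose z hz using h2
    refine ⟨monomial (-z), ?_⟩
    apply Multiplicative.toAdd.injective
    apply Subtype.ext
    funext i k
    rw [iota_apply, coord_monomial, toAdd_ofAdd]
    by_cases hik : i = k
    · subst hik
      rw [if_pos rfl]
      exact (M.2 i).symm
    · obtain ⟨l, rfl⟩ := Fin.exists_succAbove_eq hik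
      rw [if_neg hik]
      have : M.1 (k.succAbove l) k = 2 * z k := by
        rw [← hz]
        cases l using Fin.cases with
        | zero => rfl
        | succ l => exact h1 k l
      rw [this, Pi.neg_apply]
      ring
  · rintro ⟨a, ha⟩
    have h1 : ∀ (k : Fin (m + 2)) (l : Fin (m + 1)),
        M.1 (k.succAbove l) k = -2 * coord a k := by
      intro k l
      have := iota_apply a (k.succAbove l) k
      rw [ha, if_neg (Fin.succAbove_ne k l)] at this
      exact this
    refine Prod.ext ?_ ?_ <;> funext r
    · simp [matInvariants, h1]
    · simp only [matInvariants, AddMonoidHom.coe_mk, ZeroHom.coe_mk, h1]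
      exact (ZMod.intCast_zmod_eq_zero_iff_dvd _ 2).2 ⟨-coord a r, by push_cast; ring⟩

/-- `H¹(W, A) ≅ ℤ^{n(n-2)} × (ℤ/2)^n`. -/
theorem nonempty_H1_equiv {n : ℕ} (hn : 2 ≤ n) :
    Nonempty (Multiplicative ((Fin (n * (n - 2)) → ℤ) × (Fin n → ZMod 2)) ≃*
      Multiplicative (H1 n)) := by
  obtain ⟨m, rfl⟩ := Nat.exists_eq_add_of_le' hn
  let ψ := AddMonoidHom.toMultiplicative (matInvariants m)
  have hψ : Function.Surjective ψ := matInvariants_surjective m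
  have hker : ψ.ker = (toH1 (m + 2)).ker := by
    ext M
    rw [MonoidHom.mem_ker, MonoidHom.mem_ker, toH1_eq_one_iff]
    exact matInvariants_eq_zero_iff M.toAdd
  exact ⟨(QuotientGroup.quotientKerEquivOfSurjective ψ hψ).symm.trans
    ((QuotientGroup.quotientMulEquivOfEq hker).trans
      (QuotientGroup.quotientKerEquivOfSurjective _ (shortExact_left_column hn).2.2))⟩

open Classical in
/-- The signs of a `W`-equivariant automorphism of `A`. -/
noncomputable def signs (n : ℕ) : AutW n →* Multiplicative (Fin n → ZMod 2) where
  toFun u := Multiplicative.ofAdd fun k => if u.1 (sq k) = sq k then 0 else 1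
  map_one' := by
    apply Multiplicative.toAdd.injective
    funext k
    simp
  map_mul' u v := by
    apply Multiplicative.toAdd.injective
    funext k
    rw [toAdd_mul]
    simp only [toAdd_ofAdd, Pi.add_apply, Subgroup.coe_mul, MulAut.mul_apply]
    have h0 := (sq_ne_inv k).symm
    have h2 : (1 : ZMod 2) + 1 = 0 := rfl
    rcases mem_AutW_iff.1 u.2 k with h | h <;> rcases mem_AutW_iff.1 v.2 k with h' | h' <;>
      simp [h, h', h0, h2]

theorem signs_apply_eq_zero_iff {n : ℕ} (u : AutW n) (k : Fin n) :
    (signs n u).toAdd k = 0 ↔ u.1 (sq k) = sq k := by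
  classical
  change (if u.1 (sq k) = sq k then (0 : ZMod 2) else 1) = 0 ↔ _
  split_ifs with h <;> simp [h]

/-- Every sign pattern defines an involution of the free abelian group `A`; being diagonal, it is
equivariant. -/
theorem signs_bijective (n : ℕ) : Function.Bijective (signs n) := by
  constructor
  · rw [injective_iff_map_eq_one]
    intro u hu
    apply Subtype.ext
    refine mulAutA_ext fun k => ?_
    rw [(signs_apply_eq_zero_iff u k).1 (by rw [hu]; rfl)]
    rfl
  · intro f
    let φ : A n →* A n := liftA fun k => if f.toAdd k = 0 then sq k else (sq k)⁻¹
    have hφ : ∀ k, φ (sq k) = if f.toAdd k = 0 then sq k else (sq k)⁻¹ := liftA_sq _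
    have hφ2 : φ.comp φ = MonoidHom.id _ := by
      apply homA_ext
      intro k
      rw [MonoidHom.comp_apply, hφ]
      split_ifs with h <;> simp [hφ, h]
    let u : MulAut (A n) := MonoidHom.toMulEquiv φ φ hφ2 hφ2
    have hu : u ∈ AutW n := mem_AutW_iff.2 fun k => by
      change φ (sq k) = _ ∨ φ (sq k) = _
      rw [hφ]
      split_ifs <;> simp
    refine ⟨⟨u, hu⟩, ?_⟩
    apply Multiplicative.toAdd.injective
    funext k
    have h1 : (signs n ⟨u, hu⟩).toAdd k = 0 ↔ f.toAdd k = 0 := by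
      rw [signs_apply_eq_zero_iff]
      change φ (sq k) = _ ↔ _
      rw [hφ]
      have h0 := (sq_ne_inv k).symm
      split_ifs with h <;> simp [h, h0]
    have h2 : ∀ p q : ZMod 2, (p = 0 ↔ q = 0) → p = q := by decide
    exact h2 _ _ h1

end CHW

/-! ### Assembly of the diagram -/

open CHW
theorem theorem6p2 (n : ℕ) (hn : 3 ≤ n) :
    ∃ -- the maps of the middle row: `t : M_0 → Aut(G)` and `res : Aut(G) → Aut_S(A)`
      (t : Multiplicative (M0 n) →* MulAut (G n))
      (res : MulAut (G n) →* AutS n)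
      -- the maps of the left column: `ι : A → M_0` and `q : M_0 → H¹(W, A)`
      (ι : A n →* Multiplicative (M0 n))
      (q : Multiplicative (M0 n) →* Multiplicative (H1 n))
      -- the action defining `Aut_W(A) ⋊ Out(W)`, and the lower map of the right column
      (act : Out (W n) →* MulAut (AutW n))
      (κ : AutS n →* AutW n ⋊[act] Out (W n))
      -- the maps of the bottom row
      (j : Multiplicative (H1 n) →* Out (G n))
      (p : Out (G n) →* AutW n ⋊[act] Out (W n)),
      -- `t_m (x_i) = x_i (x_1²)^{m_i1} ⋯ (x_n²)^{m_in}`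
      (∀ (m : M0 n) (i : Fin n),
        t (Multiplicative.ofAdd m) (x i) = x i * (monomial (m.1 i) : G n)) ∧
      -- `res φ` is the pair of automorphisms of `A` and `W` induced by `φ`
      (∀ (φ : MulAut (G n)) (a : A n), (((res φ).1.1 a : A n) : G n) = φ a) ∧
      (∀ (φ : MulAut (G n)) (g : G n), (res φ).1.2 (g : W n) = (φ g : W n)) ∧
      -- `ι ((x_1²)^{z_1} ⋯ (x_n²)^{z_n})` has off-diagonal entries `-2 z_j` in column `j`
      (∀ (z : Fin n → ℤ) (i k : Fin n),
        (Multiplicative.toAdd (ι (monomial z))).1 i k = if i = k then 0 else -2 * z k) ∧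
      -- `q m` is the class of the cocycle `ḡ ↦ t_m(g) g⁻¹`
      (∀ m : Multiplicative (M0 n), ∃ c : groupCohomology.cocycles₁ (repA n),
        (∀ g : G n, ((Additive.toMul (c (g : W n) : Additive (A n)) : A n) : G n) = t m g * g⁻¹) ∧
        q m = Multiplicative.ofAdd (groupCohomology.H1π (repA n) c)) ∧
      -- `Out(W)` acts on `Aut_W(A)` through conjugation by semi-linear automorphisms
      (∀ (s : AutS n) (u : AutW n),
        ((act (s.1.2 : Out (W n)) u : AutW n) : MulAut (A n)) = s.1.1 * u * s.1.1⁻¹) ∧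
      -- `κ` is the canonical map on `Aut_W(A)` and over `Out(W)`
      (∀ u : AutW n, κ (AutW.toAutS n u) = SemidirectProduct.inl u) ∧
      (∀ s : AutS n, (κ s).right = (s.1.2 : Out (W n))) ∧
      -- the four squares commute
      t.comp ι = MulAut.conj.comp (A n).subtype ∧
      res.comp MulAut.conj = (wToAutS n).comp (QuotientGroup.mk' (A n)) ∧
      j.comp q = (QuotientGroup.mk' (Inn (G n))).comp t ∧
      p.comp (QuotientGroup.mk' (Inn (G n))) = κ.comp res ∧
      -- the rows are exact
      ShortExact (A n).subtype (QuotientGroup.mk' (A n)) ∧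
      ShortExact t res ∧
      ShortExact j p ∧
      -- the columns are exact
      ShortExact ι q ∧
      ShortExact (MulAut.conj : G n →* MulAut (G n)) (QuotientGroup.mk' (Inn (G n))) ∧
      ShortExact (wToAutS n) κ ∧
      -- the isomorphism type of the bottom row
      ∃ (e : Multiplicative ((Fin (n * (n - 2)) → ℤ) × (Fin n → ZMod 2)) ≃*
            Multiplicative (H1 n))
        (d : AutW n ≃* Multiplicative (Fin n → ZMod 2)),
        ShortExact (j.comp e.toMonoidHom)
          ((SemidirectProduct.congr' (φ₁ := act) d (MulEquiv.refl (Out (W n)))).toMonoidHom.comp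
            p) := by
  have hn2 : 2 ≤ n := by omega
  have htop : ShortExact (A n).subtype (QuotientGroup.mk' (A n)) :=
    ⟨Subtype.val_injective, shortExact_mk _⟩
  have hmid : ShortExact (MulAut.conj : G n →* MulAut (G n)) (QuotientGroup.mk' (Inn (G n))) :=
    ⟨conj_injective hn2, (QuotientGroup.ker_mk' _).symm, QuotientGroup.mk'_surjective _⟩
  have hbot : ShortExact (outOfH1 hn2) (outRestrict hn) :=
    shortExact_bottom_row htop (shortExact_middle_row hn) (shortExact_left_column hn2) hmid
      (shortExact_right_column hn2) (matAut_comp_iota n) (restrict_comp_conj hn)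
      (outOfH1_comp hn2) (outRestrict_comp hn)
  obtain ⟨e⟩ := nonempty_H1_equiv hn2
  refine ⟨matAut n, restrict hn, iota n, toH1 n, outAct n, kappa n, outOfH1 hn2, outRestrict hn,
    fun m i => matHom_x m i, restrict_fst hn, restrict_snd hn, fun z i k => ?_,
    fun m => ⟨matCocycle n m.toAdd, fun g => matFun_mk m.toAdd g, toH1_apply m⟩,
    outAct_apply, kappa_toAutS, fun s => rfl, matAut_comp_iota n, restrict_comp_conj hn,
    outOfH1_comp hn2, outRestrict_comp hn, htop, shortExact_middle_row hn, hbot,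
    shortExact_left_column hn2, hmid, shortExact_right_column hn2, e,
    MulEquiv.ofBijective _ (signs_bijective n), hbot.comp_mulEquiv e _⟩
  rw [iota_apply, coord_monomial]
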